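/- Let $W$ denote the principal real branch of the Lambert function, so that $W(1)$ is the real number with $W(1)\,\mathrm e^{W(1)}=1$. Let $\varepsilon>0$, let $l\ge 0$ be an integer, and assume that $$\beta^2:=-l(l+1)+\varepsilon^{-2}W(1)^2-\tfrac14>0,\qquad \beta:=\sqrt{\beta^2}>0 .$$ Let $\Lambda\le 0$ and $r_0>0$ be arbitrary, and put $V_{\mathrm{aux}}(r)=\Lambda$ for $0\le r\le r_0$ and $V_{\mathrm{aux}}(r)=-W(1)^2/r^2$ for $r>r_0$. A real number $E$ is called an eigenvalue if there is a $C^1$ function $u:(0,\infty)\to\mathbb C$, twice differentiable at every $r\ne r_0$, such that $$-\varepsilon^2\Big(u''(r)-\frac{l(l+1)}{r^2}u(r)\Big)+V_{\mathrm{aux}}(r)\,u(r)=E\,u(r)\quad (r>0,\ r\neq r_0),$$ $$u\in L^2(0,\infty),\qquad \lim_{r\to0^+}u(r)=0,\qquad \lim_{r\to0^+}r^{-(l+1)}u(r)=1 .$$ Then the negative eigenvalues, listed in increasing order, form an infinite sequence $E_0<E_1<E_2<\cdots<0$ with $E_n\to0$, and they satisfy Efimov's geometric law $$\lim_{n\to\infty}\frac{E_n}{E_{n+1}}=\mathrm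 e^{2\pi/\beta}.$$ -/

import Mathlib

open Real Set Filter Topology MeasureTheory

noncomputable section

/-- The principal real branch `W` of the Lambert function: for `x ≥ -1/e`, `W x` is the solution
`w ≥ -1` of `w * exp w = x`. -/
def lambertW (x : ℝ) : ℝ :=
  Function.invFunOn (fun w : ℝ => w * Real.exp w) (Set.Ici (-1)) x

/-- `lambertW` does what its definition promises on its whole domain. -/
theorem lambertW_spec {x : ℝ} (hx : -Real.exp (-1) ≤ x) :
    -1 ≤ lambertW x ∧ lambertW x * Real.exp (lambertW x) = x := by
  have hex : ∃ w ∈ Set.Ici (-1 : ℝ), (fun w : ℝ => w * Real.exp w) w = x := by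
    have hle : (-1 : ℝ) ≤ |x| := by linarith [abs_nonneg x]
    have hcont : ContinuousOn (fun w : ℝ => w * Real.exp w) (Set.Icc (-1) |x|) := by fun_prop
    have hup : x ≤ |x| * Real.exp |x| := by
      have h1 : (1 : ℝ) ≤ Real.exp |x| := Real.one_le_exp (abs_nonneg x)
      nlinarith [abs_nonneg x, le_abs_self x]
    obtain ⟨w, hw, hwx⟩ := intermediate_value_Icc hle hcont ⟨by simpa using hx, hup⟩
    exact ⟨w, hw.1, hwx⟩
  exact ⟨Function.invFunOn_mem hex, Function.invFunOn_eq hex⟩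

/-- The potential with a constant core `Λ` on `[0, r₀]` and the inverse-square tail
`-W(1)² / r²` for `r > r₀`. -/
def auxPotential (Λ r₀ : ℝ) (r : ℝ) : ℝ :=
  if r ≤ r₀ then Λ else -(lambertW 1) ^ 2 / r ^ 2

/-- `u` is an eigenfunction, with eigenvalue `E`, of the radial Schrödinger problem on `(0, ∞)`
with angular momentum `l` and a potential `V` that is continuous on `(0, ∞)` except possibly for a
jump at `r₀`:
`-ε² (u'' - l (l + 1) / r² u) + V u = E u`, `u ∈ L²(0, ∞)`, `u(r) → 0` and
`r ^ (-(l + 1)) u(r) → 1` as `r → 0`.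
Across `r₀` the function and its first derivative are continuous; values of `u` at `r ≤ 0` play
no role. -/
structure IsRadialEigenfunction (ε : ℝ) (l : ℕ) (V : ℝ → ℝ) (r₀ E : ℝ) (u : ℝ → ℂ) : Prop where
  contDiffOn : ContDiffOn ℝ 1 u (Set.Ioi 0)
  differentiableAt_deriv : ∀ r : ℝ, 0 < r → r ≠ r₀ → DifferentiableAt ℝ (deriv u) r
  equation : ∀ r : ℝ, 0 < r → r ≠ r₀ →
    -(ε ^ 2) • (deriv (deriv u) r - ((l : ℝ) * (l + 1) / r ^ 2) • u r) + V r • u r = E • u r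
  memLp : MemLp u 2 (volume.restrict (Set.Ioi 0))
  tendsto_zero : Tendsto u (𝓝[>] 0) (𝓝 0)
  normalized : Tendsto (fun r : ℝ => (r ^ (l + 1))⁻¹ • u r) (𝓝[>] 0) (𝓝 1)

/-- `E` is an eigenvalue of the radial problem with potential `auxPotential Λ r₀`. -/
def IsAuxEigenvalue (ε : ℝ) (l : ℕ) (Λ r₀ E : ℝ) : Prop :=
  ∃ u : ℝ → ℂ, IsRadialEigenfunction ε l (auxPotential Λ r₀) r₀ E u

/-- The quantity `β² = -l (l + 1) + ε⁻² W(1)² - 1/4`. -/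
def efimovBetaSq (ε : ℝ) (l : ℕ) : ℝ :=
  -((l : ℝ) * (l + 1)) + (lambertW 1) ^ 2 / ε ^ 2 - 1 / 4

/-- The Efimov parameter `β`. -/
def efimovBeta (ε : ℝ) (l : ℕ) : ℝ := Real.sqrt (efimovBetaSq ε l)

end

/-! Write `E = -ε²κ²`. On `(0, r₀)` the normalisation at the origin leaves one solution, `r^(l+1)
₀F₁(l+3/2; q r²/4)` with `q = Λ/ε² + κ²`. On `(r₀, ∞)` the substitution `ψ(r) = √r v(log(κr))` turns
the equation into `v'' = (e^{2t} - β²) v`, and square integrability leaves only its recessive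
solution (a multiple of the Bessel function `K_{iβ}(e^t)`). Hence `E` is an eigenvalue exactly when
the Wronskian of the two vanishes at `r₀`; this is `wronskian_eq_zero_of_isAuxEigenvalue` and its
converse.

With `t = log(κr₀)` the Wronskian is, up to a nonzero factor, the imaginary part of a product `Z(t)
Y(t)`: `Z` encodes the recessive data, `Y` the regular data. Both arguments increase strictly with
`t`, by the positivity of two quadratic forms (`recessive_form_pos`, `hypLimit_form_pos`). As `t →
-∞`, `Z` behaves like `C e^{iβt}` while `Y` tends to a nonzero constant, so the total phase is `βt +
d + o(1)`. For large `t` a sign argument excludes zeros. The zeros therefore form a sequence `τ n →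
-∞` with gaps tending to `π/β` (`exists_phase_sequence`), and `E n / E (n+1) = e^{2(τ n - τ (n+1))}`
tends to `e^{2π/β}`. -/

noncomputable section

/-! ### The function `₀F₁` and its differential equation. -/

/-- The coefficients of the confluent hypergeometric limit function. -/
def hypCoeff {𝕜 : Type*} [RCLike 𝕜] (c : 𝕜) (k : ℕ) : 𝕜 :=
  ((k.factorial : 𝕜) * ∏ j ∈ Finset.range k, (c + j))⁻¹

/-- The confluent hypergeometric limit function `₀F₁(c; z)`. -/
def hypLimit {𝕜 : Type*} [RCLike 𝕜] (c z : 𝕜) : 𝕜 := ∑' k : ℕ, hypCoeff c k * z ^ k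

section hyp
variable {𝕜 : Type*} [RCLike 𝕜] {c : 𝕜}

/-- The hypothesis on `c` avoids the poles and makes the exponential series a majorant. It covers
both parameters needed later: real `c ≥ 1`, and `c = 1 + iβ`. -/
theorem norm_hypCoeff_le (hc : ∀ k : ℕ, 1 ≤ ‖c + k‖) (k : ℕ) :
    ‖hypCoeff c k‖ ≤ (k.factorial : ℝ)⁻¹ := by
  have h : (1 : ℝ) ≤ ∏ j ∈ Finset.range k, ‖c + (j : 𝕜)‖ :=
    Finset.one_le_prod fun j _ => hc j
  rw [hypCoeff, norm_inv, norm_mul, norm_prod, RCLike.norm_natCast]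
  have hk : (0 : ℝ) < k.factorial := by positivity
  gcongr
  nlinarith

theorem add_ne_zero_of_one_le_norm (hc : ∀ k : ℕ, 1 ≤ ‖c + k‖) (k : ℕ) : c + (k : 𝕜) ≠ 0 := by
  intro h
  have := hc k
  rw [h, norm_zero] at this
  linarith

theorem one_le_norm_succ (hc : ∀ k : ℕ, 1 ≤ ‖c + k‖) (k : ℕ) : 1 ≤ ‖c + 1 + k‖ := by
  have := hc (k + 1)
  push_cast at this
  rwa [add_assoc, add_comm (1 : 𝕜)]

theorem hypCoeff_zero : hypCoeff c 0 = 1 := by simp [hypCoeff]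

/-- Coefficient form of `f_c' = f_{c+1} / c`. -/
theorem succ_mul_hypCoeff_succ (k : ℕ) :
    ((k : 𝕜) + 1) * hypCoeff c (k + 1) = hypCoeff (c + 1) k / c := by
  have h1 : ((k : 𝕜) + 1) ≠ 0 := by exact_mod_cast Nat.succ_ne_zero k
  rw [hypCoeff, hypCoeff, Finset.prod_range_succ', Nat.factorial_succ]
  have : ∏ j ∈ Finset.range k, (c + ((j + 1 : ℕ) : 𝕜)) = ∏ j ∈ Finset.range k, (c + 1 + (j : 𝕜)) :=
    Finset.prod_congr rfl fun j _ => by push_cast; ring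
  rw [this]
  push_cast
  rw [add_zero, div_eq_mul_inv, ← mul_inv]
  nth_rewrite 1 [← inv_inv ((k : 𝕜) + 1)]
  rw [← mul_inv]
  congr 1
  field_simp

theorem hypCoeff_succ_add (hc : ∀ k : ℕ, 1 ≤ ‖c + k‖) (k : ℕ) :
    hypCoeff (c + 1) k * (c + k) = c * hypCoeff c k := by
  have h0 : c ≠ 0 := by simpa using add_ne_zero_of_one_le_norm hc 0
  have h2 := Finset.prod_range_succ (fun j : ℕ => c + (j : 𝕜)) k
  rw [Finset.prod_range_succ'] at h2
  have : ∏ j ∈ Finset.range k, (c + ((j + 1 : ℕ) : 𝕜)) = ∏ j ∈ Finset.range k, (c + 1 + (j : 𝕜)) :=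
    Finset.prod_congr rfl fun j _ => by push_cast; ring
  rw [this, Nat.cast_zero, add_zero] at h2
  have hf : (k.factorial : 𝕜) ≠ 0 := by exact_mod_cast k.factorial_ne_zero
  have hA : ∏ j ∈ Finset.range k, (c + (j : 𝕜)) ≠ 0 :=
    Finset.prod_ne_zero_iff.2 fun j _ => add_ne_zero_of_one_le_norm hc j
  have hB : ∏ j ∈ Finset.range k, (c + 1 + (j : 𝕜)) ≠ 0 :=
    Finset.prod_ne_zero_iff.2 fun j _ => add_ne_zero_of_one_le_norm (one_le_norm_succ hc) j
  rw [hypCoeff, hypCoeff]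
  field_simp
  linear_combination -h2

theorem summable_hypLimit (hc : ∀ k : ℕ, 1 ≤ ‖c + k‖) (z : 𝕜) :
    Summable fun k : ℕ => hypCoeff c k * z ^ k := by
  refine Summable.of_norm_bounded (Real.summable_pow_div_factorial ‖z‖) fun k => ?_
  rw [norm_mul, norm_pow, div_eq_inv_mul]
  gcongr
  exact norm_hypCoeff_le hc k

theorem hypLimit_zero : hypLimit c 0 = 1 := by
  rw [hypLimit, tsum_eq_single 0]
  · simp [hypCoeff_zero]
  · intro k hk
    simp [hk]

theorem hasDerivAt_hypLimit (hc : ∀ k : ℕ, 1 ≤ ‖c + k‖) (z : 𝕜) :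
    HasDerivAt (hypLimit c) (hypLimit (c + 1) z / c) z := by
  -- Any radius beyond `‖z‖` serves: termwise differentiation needs one summable majorant on a ball
  -- containing `z`.
  set R : ℝ := ‖z‖ + 1 with hR
  have hR0 : 0 ≤ R := by positivity
  have hu : Summable fun k : ℕ => (k : ℝ) * (k.factorial : ℝ)⁻¹ * R ^ (k - 1) := by
    rw [← summable_nat_add_iff 1]
    refine (Real.summable_pow_div_factorial R).congr fun k => ?_
    rw [Nat.factorial_succ, Nat.add_sub_cancel]
    push_cast
    field_simp
  have key := hasDerivAt_tsum_of_isPreconnected (𝕜 := 𝕜)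
    (g := fun (k : ℕ) (y : 𝕜) => hypCoeff c k * y ^ k)
    (g' := fun (k : ℕ) (y : 𝕜) => hypCoeff c k * (k * y ^ (k - 1))) (t := Metric.ball 0 R)
    (y₀ := 0) (y := z) hu Metric.isOpen_ball (Metric.isConnected_ball (by positivity)).isPreconnected
    (fun k y _ => (hasDerivAt_pow k y).const_mul _) ?_ (Metric.mem_ball_self (by positivity))
    (summable_hypLimit hc 0) (by simp [hR])
  · have hs : Summable fun k : ℕ => hypCoeff c k * ((k : 𝕜) * z ^ (k - 1)) := by
      refine Summable.of_norm_bounded hu fun k => ?_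
      rw [norm_mul, norm_mul, norm_pow, RCLike.norm_natCast]
      have := norm_hypCoeff_le hc k
      have h2 : ‖z‖ ^ (k - 1) ≤ R ^ (k - 1) := by gcongr; linarith
      calc _ ≤ (k.factorial : ℝ)⁻¹ * (k * R ^ (k - 1)) := by gcongr
        _ = _ := by ring
    suffices he : ∑' k : ℕ, hypCoeff c k * ((k : 𝕜) * z ^ (k - 1)) = hypLimit (c + 1) z / c by
      rw [← he]; exact key
    rw [hs.tsum_eq_zero_add, hypLimit, ← tsum_div_const]
    simp only [Nat.cast_zero, zero_mul, mul_zero, zero_add]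
    refine tsum_congr fun k => ?_
    have := succ_mul_hypCoeff_succ (c := c) k
    rw [Nat.add_sub_cancel]
    push_cast
    linear_combination (z ^ k) * this
  · intro k y hy
    rw [norm_mul, norm_mul, norm_pow, RCLike.norm_natCast]
    have := norm_hypCoeff_le hc k
    have hy' : ‖y‖ ≤ R := by simpa using (Metric.mem_ball.1 hy).le
    have h2 : ‖y‖ ^ (k - 1) ≤ R ^ (k - 1) := by gcongr
    calc _ ≤ (k.factorial : ℝ)⁻¹ * (k * R ^ (k - 1)) := by gcongr
      _ = _ := by ring

/-- The contiguity relation equivalent to the differential equation `z f'' + c f' = f`. -/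
theorem hypLimit_contiguous (hc : ∀ k : ℕ, 1 ≤ ‖c + k‖) (z : 𝕜) :
    z * (hypLimit (c + 1 + 1) z / (c + 1) / c) + c * (hypLimit (c + 1) z / c) = hypLimit c z := by
  have h0 : c ≠ 0 := by simpa using add_ne_zero_of_one_le_norm hc 0
  have hc1 := one_le_norm_succ hc
  have h1 : c + 1 ≠ 0 := by simpa using add_ne_zero_of_one_le_norm hc1 0
  rw [mul_div_cancel₀ _ h0]
  have s1 := summable_hypLimit hc1 z
  have s0 := summable_hypLimit hc z
  have s2 := summable_hypLimit (one_le_norm_succ hc1) z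
  have e2 : z * (hypLimit (c + 1 + 1) z / (c + 1) / c) =
      ∑' k : ℕ, z * (hypCoeff (c + 1 + 1) k * z ^ k / (c + 1) / c) := by
    rw [tsum_mul_left, tsum_div_const, tsum_div_const]; rfl
  rw [e2, hypLimit, hypLimit, s1.tsum_eq_zero_add, s0.tsum_eq_zero_add, hypCoeff_zero,
    hypCoeff_zero, add_left_comm, ← Summable.tsum_add]
  · congr 1
    refine tsum_congr fun k => ?_
    have e1 := succ_mul_hypCoeff_succ (c := c + 1) k
    have e3 := hypCoeff_succ_add hc (k + 1)
    push_cast at e3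
    have : hypCoeff c (k + 1) = hypCoeff (c + 1) (k + 1) * (c + (k + 1)) / c := by
      rw [e3]; field_simp
    rw [this]
    have e4 : hypCoeff (c + 1 + 1) k = (k + 1) * hypCoeff (c + 1) (k + 1) * (c + 1) := by
      rw [e1]; field_simp
    rw [e4]
    field_simp
    ring
  · have s3 : Summable fun k : ℕ => hypCoeff (c + 1 + 1) k * z ^ k / (c + 1) / c :=
      (s2.div_const (c + 1)).div_const c
    exact s3.mul_left z
  · exact (summable_nat_add_iff (f := fun k : ℕ => hypCoeff (c + 1) k * z ^ k) 1).2 s1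

end hyp

theorem one_le_hypLimit {c x : ℝ} (hc : 1 ≤ c) (hx : 0 ≤ x) : 1 ≤ hypLimit c x := by
  have hc' : ∀ k : ℕ, 1 ≤ ‖c + k‖ := fun k => by
    have : (0 : ℝ) ≤ k := k.cast_nonneg
    rw [Real.norm_of_nonneg] <;> linarith
  have h := (summable_hypLimit hc' x).le_tsum 0 fun k _ => by
    unfold hypCoeff; positivity
  simpa [hypCoeff_zero, hypLimit] using h

/-! ### Continuous phases of plane curves and the zeros of their sine. -/

/-- A nonvanishing `C¹` curve in the plane has a `C¹` logarithm. -/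
theorem exists_complex_log_lift {M M' : ℝ → ℂ} (hM : ∀ t, HasDerivAt M (M' t) t)
    (hM' : Continuous M') (h0 : ∀ t, M t ≠ 0) :
    ∃ L : ℝ → ℂ, (∀ t, HasDerivAt L (M' t / M t) t) ∧ ∀ t, Complex.exp (L t) = M t := by
  have hMc : Continuous M := continuous_iff_continuousAt.2 fun t => (hM t).continuousAt
  have hc : Continuous fun t => M' t / M t := hM'.div hMc h0
  let L : ℝ → ℂ := fun t => Complex.log (M 0) + ∫ s in (0 : ℝ)..t, M' s / M s
  have hL : ∀ t, HasDerivAt L (M' t / M t) t := fun t => by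
    have := (intervalIntegral.integral_hasDerivAt_right (hc.intervalIntegrable 0 t)
      hc.aestronglyMeasurable.stronglyMeasurableAtFilter hc.continuousAt).const_add
        (Complex.log (M 0))
    exact this
  refine ⟨L, hL, fun t => ?_⟩
  have hd : ∀ t, HasDerivAt (fun t => Complex.exp (-L t) * M t) 0 t := fun t => by
    refine HasDerivAt.congr_deriv ((HasDerivAt.cexp (hL t).fun_neg).mul (hM t)) ?_
    have := h0 t
    field_simp
    ring
  have hconst := is_const_of_deriv_eq_zero (fun t => (hd t).differentiableAt)
    (fun t => (hd t).deriv) t 0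
  have hL0 : L 0 = Complex.log (M 0) := by simp [L]
  simp only [hL0, Complex.exp_neg, Complex.exp_log (h0 0), inv_mul_cancel₀ (h0 0)] at hconst
  have := Complex.exp_ne_zero (L t)
  field_simp at hconst
  exact hconst.symm

/-- If the exponential of a differentiable curve converges to a nonzero limit, so does the curve. -/
theorem exists_tendsto_of_tendsto_exp {g g' : ℝ → ℂ} {C : ℂ} (hg : ∀ t, HasDerivAt g (g' t) t)
    (hC : C ≠ 0) (h : Tendsto (fun t => Complex.exp (g t)) atBot (𝓝 C)) :
    ∃ d, Tendsto g atBot (𝓝 d) := by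
  have h1 : Tendsto (fun t => Complex.exp (g t) / C) atBot (𝓝 1) := by
    simpa [hC] using h.div_const C
  have hlog : Tendsto (fun t => Complex.log (Complex.exp (g t) / C)) atBot (𝓝 0) := by
    have := (continuousAt_clog Complex.one_mem_slitPlane).tendsto.comp h1
    simpa [Function.comp_def] using this
  have hev : ∀ᶠ t in atBot, Complex.exp (g t) / C ∈ Complex.slitPlane :=
    h1.eventually (Complex.isOpen_slitPlane.mem_nhds Complex.one_mem_slitPlane)
  obtain ⟨T, hT⟩ := eventually_atBot.1 hev
  -- For `t < T` the quotient `exp (g t) / C` stays in the slit plane, so `g` and the principal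
  -- logarithm have the same derivative and differ by a constant.
  have hd : ∀ t ∈ Iio T, HasDerivAt (fun t => g t - Complex.log (Complex.exp (g t) / C)) 0 t := by
    intro t ht
    refine HasDerivAt.congr_deriv
      ((hg t).sub ((((hg t).cexp).div_const C).clog_real (hT t (le_of_lt ht)))) ?_
    have := Complex.exp_ne_zero (g t)
    field_simp
    ring
  have hconst : ∀ t ∈ Iio T, g t - Complex.log (Complex.exp (g t) / C) =
      g (T - 1) - Complex.log (Complex.exp (g (T - 1)) / C) := fun t ht =>
    isOpen_Iio.is_const_of_deriv_eq_zero isPreconnected_Iio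
      (fun t ht => (hd t ht).differentiableAt.differentiableWithinAt)
      (fun t ht => (hd t ht).deriv) ht (by simp)
  refine ⟨_, (((hlog.add_const (g (T - 1) - Complex.log (Complex.exp (g (T - 1)) / C)))).congr'
    ?_)⟩
  filter_upwards [Iio_mem_atBot T] with t ht
  rw [← hconst t ht]
  ring

/-- The zeros of the sine of an increasing phase that is asymptotically linear at `-∞`. -/
theorem exists_phase_sequence {θ : ℝ → ℝ} {β d T : ℝ} (hβ : 0 < β) (hmono : StrictMono θ)
    (hcont : Continuous θ) (hlim : Tendsto (fun t => θ t - β * t) atBot (𝓝 d))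
    (hT : ∀ t, T ≤ t → Real.sin (θ t) ≠ 0) :
    ∃ τ : ℕ → ℝ, StrictAnti τ ∧ range τ = {t | Real.sin (θ t) = 0} ∧ Tendsto τ atTop atBot ∧
      Tendsto (fun n => τ n - τ (n + 1)) atTop (𝓝 (π / β)) := by
  have hbot : Tendsto θ atBot atBot := by
    have h1 : Tendsto (fun t : ℝ => β * t) atBot atBot := tendsto_id.const_mul_atBot hβ
    have := hlim.add_atBot h1
    simpa using this
  have hlow : ∀ y, (∃ t, y ≤ θ t) → ∃ t, θ t = y := by
    rintro y ⟨t, ht⟩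
    obtain ⟨s, hs, hst⟩ := ((hbot.eventually (eventually_le_atBot y)).and
      (eventually_le_atBot t)).exists
    obtain ⟨x, -, hx⟩ := intermediate_value_Icc hst hcont.continuousOn ⟨hs, ht⟩
    exact ⟨x, hx⟩
  have hbdd : ∃ b : ℤ, ∀ k : ℤ, (∃ t, θ t = k * π) → k ≤ b := by
    refine ⟨⌈θ T / π⌉, ?_⟩
    rintro k ⟨t, ht⟩
    have htT : t < T := by
      by_contra! hc
      exact hT t hc (by rw [ht]; exact Real.sin_int_mul_pi k)
    have : (k : ℝ) * π < θ T := ht ▸ hmono htT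
    have h2 : (k : ℝ) < θ T / π := by rwa [lt_div_iff₀ Real.pi_pos]
    exact_mod_cast (h2.trans_le (Int.le_ceil _)).le
  have hne : ∃ k : ℤ, ∃ t, θ t = k * π := by
    refine ⟨⌊θ 0 / π⌋, hlow _ ⟨0, ?_⟩⟩
    rw [← le_div_iff₀ Real.pi_pos]
    exact Int.floor_le _
  -- `k₀ π` is the largest multiple of `π` attained by `θ`; the zeros are the preimages `τ n` of
  -- `(k₀ - n) π`.
  obtain ⟨k₀, ⟨t₀, ht₀⟩, hk₀⟩ := Int.exists_greatest_of_bdd hbdd hne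
  have hex : ∀ n : ℕ, ∃ t, θ t = (k₀ - n : ℝ) * π := fun n => hlow _ ⟨t₀, by
    rw [ht₀]
    have : (0 : ℝ) ≤ n := n.cast_nonneg
    have := Real.pi_pos
    nlinarith⟩
  choose τ hτ using hex
  have hτbot : Tendsto τ atTop atBot := by
    refine tendsto_atBot.2 fun b => ?_
    have h1 : Tendsto (fun n : ℕ => ((k₀ : ℝ) - n) * π) atTop atBot := by
      refine Tendsto.atBot_mul_const Real.pi_pos ?_
      simp only [sub_eq_add_neg]
      exact tendsto_atBot_add_const_left _ _ (tendsto_neg_atTop_atBot.comp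
        tendsto_natCast_atTop_atTop)
    filter_upwards [h1.eventually (eventually_le_atBot (θ b))] with n hn
    rw [← hτ] at hn
    exact hmono.le_iff_le.1 hn
  refine ⟨τ, ?_, ?_, hτbot, ?_⟩
  · refine strictAnti_nat_of_succ_lt fun n => hmono.lt_iff_lt.1 ?_
    rw [hτ, hτ]
    have := Real.pi_pos
    push_cast
    nlinarith
  · ext t
    constructor
    · rintro ⟨n, rfl⟩
      have : θ (τ n) = ((k₀ - n : ℤ) : ℝ) * π := by rw [hτ]; push_cast; ring
      change Real.sin _ = 0
      rw [this]
      exact Real.sin_int_mul_pi _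
    · intro ht
      obtain ⟨k, hk⟩ := Real.sin_eq_zero_iff.1 ht
      have hle := hk₀ k ⟨t, hk.symm⟩
      refine ⟨(k₀ - k).toNat, hmono.injective ?_⟩
      rw [hτ, ← hk]
      have : (((k₀ - k).toNat : ℤ) : ℝ) = k₀ - k := by
        rw [Int.toNat_of_nonneg (by omega)]; push_cast; ring
      rw [Int.cast_natCast] at this
      rw [this]
      ring
  -- The phase drops by exactly `π` from `τ n` to `τ (n + 1)`, so `β (τ n - τ (n + 1))` is `π` minus
  -- a difference of two terms with the same limit `d`.
  · have h1 := hlim.comp hτbot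
    have h2 := (h1.sub (h1.comp (tendsto_add_atTop_nat 1))).const_sub π
    have h3 := h2.div_const β
    simp only [sub_self, sub_zero] at h3
    refine h3.congr fun n => ?_
    simp only [Function.comp_apply, hτ]
    push_cast
    field_simp
    ring

/-! ### The equation `v'' = (e^{2t} - β²) v` and its recessive solution. -/

/-- The equation `J'' = (e^{2t} - β²) J` has a complex solution asymptotic to `e^{iβt}` at `-∞`. -/
theorem exists_oscillating_solution (β : ℝ) :
    ∃ A B : ℝ → ℂ, Tendsto A atBot (𝓝 1) ∧ Tendsto B atBot (𝓝 (Complex.I * β)) ∧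
      (∀ t : ℝ, HasDerivAt (fun t : ℝ => Complex.exp (Complex.I * β * t) * A t)
        (Complex.exp (Complex.I * β * t) * B t) t) ∧
      ∀ t : ℝ, HasDerivAt (fun t : ℝ => Complex.exp (Complex.I * β * t) * B t)
        (((Real.exp (2 * t) - β ^ 2 : ℝ) : ℂ) * (Complex.exp (Complex.I * β * t) * A t)) t := by
  -- The solution is `e^{iβt} ₀F₁(1 + iβ; e^{2t}/4)`, a constant multiple of the modified Bessel
  -- function `I_{iβ}(e^t)`.
  set c : ℂ := 1 + Complex.I * β with hcdef
  have hc : ∀ k : ℕ, 1 ≤ ‖c + k‖ := fun k => by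
    refine le_trans ?_ (Complex.re_le_norm _)
    simp [hcdef]
  set x : ℝ → ℂ := fun t => ((Real.exp (2 * t) / 4 : ℝ) : ℂ) with hx
  have hxd : ∀ t, HasDerivAt x (2 * x t) t := fun t => by
    have h1 : HasDerivAt (fun t : ℝ => 2 * t) 2 t := by
      simpa using (hasDerivAt_id t).const_mul (2 : ℝ)
    refine HasDerivAt.congr_deriv ((h1.exp.div_const 4).ofReal_comp) ?_
    simp only [hx]
    push_cast
    ring
  have hx0 : Tendsto x atBot (𝓝 0) := by
    have h1 : Tendsto (fun t : ℝ => 2 * t) atBot atBot := tendsto_id.const_mul_atBot two_pos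
    have h2 := (Real.tendsto_exp_atBot.comp h1).div_const 4
    rw [zero_div] at h2
    have := (Complex.continuous_ofReal.tendsto 0).comp h2
    rw [Complex.ofReal_zero] at this
    exact this
  set F : ℝ → ℂ := fun t => hypLimit c (x t) with hF
  set G : ℝ → ℂ := fun t => hypLimit (c + 1) (x t) / c with hG
  set K : ℝ → ℂ := fun t => hypLimit (c + 1 + 1) (x t) / (c + 1) / c with hK
  have hc1 := one_le_norm_succ hc
  have hFd : ∀ t, HasDerivAt F (G t * (2 * x t)) t := fun t =>
    (hasDerivAt_hypLimit hc (x t)).comp t (hxd t)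
  have hGd : ∀ t, HasDerivAt G (K t * (2 * x t)) t := fun t =>
    ((hasDerivAt_hypLimit hc1 (x t)).div_const c).comp t (hxd t)
  have hode : ∀ t, x t * K t + c * G t = F t := fun t => hypLimit_contiguous hc (x t)
  have hF1 : Tendsto F atBot (𝓝 1) := by
    have := (hasDerivAt_hypLimit hc 0).continuousAt.tendsto.comp hx0
    rw [hypLimit_zero] at this
    exact this
  have hG1 : Tendsto G atBot (𝓝 (1 / c)) := by
    have := ((hasDerivAt_hypLimit hc1 0).continuousAt.tendsto.comp hx0).div_const c
    rw [hypLimit_zero] at this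
    exact this
  have hed : ∀ t : ℝ, HasDerivAt (fun t : ℝ => Complex.exp (Complex.I * β * t))
      (Complex.exp (Complex.I * β * t) * (Complex.I * β)) t := fun t => by
    have h1 : HasDerivAt (fun t : ℝ => Complex.I * β * (t : ℂ)) (Complex.I * β) t := by
      simpa using (hasDerivAt_id t).ofReal_comp.const_mul (Complex.I * (β : ℂ))
    exact h1.cexp
  refine ⟨F, fun t => Complex.I * β * F t + 2 * x t * G t, hF1, ?_, fun t => ?_, fun t => ?_⟩
  · have := (hF1.const_mul (Complex.I * (β : ℂ))).add ((hx0.const_mul 2).mul hG1)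
    simpa using this
  · refine HasDerivAt.congr_deriv ((hed t).mul (hFd t)) ?_
    ring
  · refine HasDerivAt.congr_deriv ((hed t).mul (((hFd t).const_mul (Complex.I * (β : ℂ))).add
      (((hxd t).const_mul 2).mul (hGd t)))) ?_
    have h4 : ((Real.exp (2 * t) - β ^ 2 : ℝ) : ℂ) = 4 * x t - β ^ 2 := by
      simp only [hx]; push_cast; ring
    rw [h4, ← hode t, hcdef]
    linear_combination (Complex.exp (Complex.I * β * t) * β ^ 2 *
      (x t * K t + (1 + Complex.I * β) * G t)) * Complex.I_sq

/-- The recessive solution at `+∞` of `v'' = (e^{2t} - β²) v`, with its phase at `-∞`. -/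
theorem exists_recessive_solution {β : ℝ} (hβ : 0 < β) :
    ∃ (v w : ℝ → ℝ) (t₀ : ℝ) (C : ℂ), C ≠ 0 ∧ (∀ t, HasDerivAt v (w t) t) ∧
      (∀ t, HasDerivAt w ((Real.exp (2 * t) - β ^ 2) * v t) t) ∧
      (∀ t, t₀ ≤ t → v t * w t ≤ 0) ∧ (∀ t, v t = 0 → w t ≠ 0) ∧
      Tendsto (fun t : ℝ => ((β : ℂ) * v t - Complex.I * w t) *
        Complex.exp (-(Complex.I * β * t))) atBot (𝓝 C) := by
  obtain ⟨A, B, hA, hB, hJ, hJ'⟩ := exists_oscillating_solution β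
  set e : ℝ → ℂ := fun t => Complex.exp (Complex.I * β * t) with he
  have hee : ∀ t, (starRingEnd ℂ) (e t) * e t = 1 := fun t => by
    simp only [he, ← Complex.exp_conj, ← Complex.exp_add]
    simp
  have hen : ∀ t, (starRingEnd ℂ) (e t) = Complex.exp (-(Complex.I * β * t)) := fun t => by
    simp only [he, ← Complex.exp_conj]
    simp
  have hre : ∀ (c : ℂ) {f : ℝ → ℂ} {f' : ℂ} {t : ℝ}, HasDerivAt f f' t →
      HasDerivAt (fun t => (c * f t).re) (c * f').re t := fun c f f' t h =>
    Complex.reCLM.hasFDerivAt.comp_hasDerivAt t (h.const_mul c)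
  -- Real solutions are parametrised by `c` as `Re (c J)`, with derivative `U c`.
  set V : ℂ → ℝ → ℝ := fun c t => (c * (e t * A t)).re with hV
  set U : ℂ → ℝ → ℝ := fun c t => (c * (e t * B t)).re with hU
  have hVd : ∀ c t, HasDerivAt (V c) (U c t) t := fun c t => hre c (hJ t)
  have hUd : ∀ c t, HasDerivAt (U c) ((Real.exp (2 * t) - β ^ 2) * V c t) t := fun c t => by
    have := hre c (hJ' t)
    rw [mul_left_comm, Complex.re_ofReal_mul] at this
    exact this
  -- the Wronskian of the solution and its conjugate
  have hwr : ∀ t, ((starRingEnd ℂ) (A t) * B t).im = β := by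
    have hd : ∀ t, HasDerivAt (fun t => ((starRingEnd ℂ) (e t * A t) * (e t * B t)).im) 0 t := by
      intro t
      have hs : HasDerivAt (fun t => (starRingEnd ℂ) (e t * A t))
          ((starRingEnd ℂ) (e t * B t)) t := (hJ t).star
      refine HasDerivAt.congr_deriv
        (Complex.imCLM.hasFDerivAt.comp_hasDerivAt t (hs.mul (hJ' t))) ?_
      have h1 : (starRingEnd ℂ) (e t * B t) * (e t * B t) + (starRingEnd ℂ) (e t * A t) *
          (((Real.exp (2 * t) - β ^ 2 : ℝ) : ℂ) * (e t * A t)) =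
          ((Complex.normSq (e t * B t) + (Real.exp (2 * t) - β ^ 2) *
            Complex.normSq (e t * A t) : ℝ) : ℂ) := by
        rw [Complex.ofReal_add, Complex.ofReal_mul, Complex.normSq_eq_conj_mul_self,
          Complex.normSq_eq_conj_mul_self]
        ring
      rw [Complex.imCLM_apply]
      exact (congrArg Complex.im h1).trans (Complex.ofReal_im _)
    have hE : ∀ t, (starRingEnd ℂ) (e t * A t) * (e t * B t) = (starRingEnd ℂ) (A t) * B t := by
      intro t
      rw [map_mul]
      linear_combination ((starRingEnd ℂ) (A t) * B t) * hee t
    simp only [hE] at hd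
    have hlim : Tendsto (fun t => ((starRingEnd ℂ) (A t) * B t).im) atBot (𝓝 β) := by
      have h1 := ((Complex.continuous_conj.tendsto 1).comp hA).mul hB
      have h2 := (Complex.continuous_im.tendsto _).comp h1
      simpa [Function.comp_def] using h2
    intro t
    have hcst : ∀ s, ((starRingEnd ℂ) (A s) * B s).im = ((starRingEnd ℂ) (A t) * B t).im :=
      fun s => is_const_of_deriv_eq_zero (fun t => (hd t).differentiableAt)
        (fun t => (hd t).deriv) s t
    simp only [hcst] at hlim
    exact tendsto_nhds_unique tendsto_const_nhds hlim
  -- If `cJ` and `cJ'` were both purely imaginary, `conj (cJ) · cJ'` would be real, but its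
  -- imaginary part is `|c|² β`.
  have hVU : ∀ c : ℂ, c ≠ 0 → ∀ t, V c t = 0 → U c t ≠ 0 := by
    intro c hc t h1 h2
    have h3 := hwr t
    have h4 : (starRingEnd ℂ) (c * (e t * A t)) * (c * (e t * B t)) =
        (Complex.normSq c : ℂ) * ((starRingEnd ℂ) (A t) * B t) := by
      rw [map_mul, map_mul, Complex.normSq_eq_conj_mul_self]
      linear_combination ((starRingEnd ℂ) c * c * (starRingEnd ℂ) (A t) * B t) * hee t
    have h5 := congrArg Complex.im h4
    rw [Complex.im_ofReal_mul, h3, Complex.mul_im, Complex.conj_re, Complex.conj_im] at h5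
    change (c * (e t * A t)).re = 0 at h1
    change (c * (e t * B t)).re = 0 at h2
    rw [h1, h2, zero_mul, mul_zero, add_zero] at h5
    have h6 := Complex.normSq_pos.2 hc
    have := mul_pos h6 hβ
    linarith
  -- beyond `t₀` the product of a solution with its derivative increases
  set t₀ : ℝ := Real.log β with ht₀
  have hq : ∀ t, t₀ ≤ t → 0 ≤ Real.exp (2 * t) - β ^ 2 := fun t ht => by
    have h1 : β ≤ Real.exp t := by rw [← Real.exp_log hβ]; exact Real.exp_le_exp.2 ht
    have h2 : Real.exp (2 * t) = Real.exp t ^ 2 := by rw [← Real.exp_nat_mul]; norm_num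
    rw [h2]
    nlinarith
  have hmono : ∀ c, MonotoneOn (fun t => V c t * U c t) (Ici t₀) := fun c => by
    have hd : ∀ t, HasDerivAt (fun t => V c t * U c t)
        (U c t * U c t + V c t * ((Real.exp (2 * t) - β ^ 2) * V c t)) t :=
      fun t => (hVd c t).mul (hUd c t)
    refine monotoneOn_of_deriv_nonneg (convex_Ici _)
      (fun t _ => (hd t).continuousAt.continuousWithinAt)
      (fun t _ => (hd t).differentiableAt.differentiableWithinAt) fun t ht => ?_
    rw [interior_Ici] at ht
    rw [(hd t).deriv]
    have := hq t (le_of_lt ht)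
    nlinarith [mul_nonneg this (mul_self_nonneg (V c t)), mul_self_nonneg (U c t)]
  -- The recessive solution comes from compactness. Since `V c * U c` increases on `[t₀, ∞)`, the
  -- sets `S n` are nested; a `c` in all of them gives `V c * U c ≤ 0` on the whole half-line.
  set S : ℕ → Set ℂ := fun n => Metric.sphere 0 1 ∩ {c | V c (t₀ + n) * U c (t₀ + n) ≤ 0} with hS
  have hclosed : ∀ n, IsClosed {c : ℂ | V c (t₀ + n) * U c (t₀ + n) ≤ 0} := fun n =>
    isClosed_le (by simp only [hV, hU]; fun_prop) continuous_const
  have hcompact : ∀ n, IsCompact (S n) := fun n => (isCompact_sphere 0 1).inter_right (hclosed n)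
  have hnonempty : ∀ n, (S n).Nonempty := fun n => by
    set z := e (t₀ + n) * A (t₀ + n) with hz
    by_cases h0 : z = 0
    · exact ⟨1, by simp, by simp only [hV, mem_ofPred_eq, ← hz, h0]; simp⟩
    -- This unit `c` rotates `J` at `t₀ + n` onto the imaginary axis, so `V c` vanishes there.
    · refine ⟨Complex.I * (starRingEnd ℂ) z / (‖z‖ : ℂ), ?_, ?_⟩
      · simp [h0]
      · have h1 : V (Complex.I * (starRingEnd ℂ) z / (‖z‖ : ℂ)) (t₀ + n) = 0 := by
          simp only [hV, ← hz]
          rw [div_mul_eq_mul_div, mul_assoc, mul_comm ((starRingEnd ℂ) z), Complex.mul_conj,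
            Complex.div_ofReal_re]
          simp
        simp only [mem_ofPred_eq, h1, zero_mul, le_refl]
  obtain ⟨c, hc⟩ := IsCompact.nonempty_iInter_of_sequence_nonempty_isCompact_isClosed S
    (fun n c hc => ⟨hc.1, (hmono c (by simp)
      (by simp only [mem_Ici]; push_cast; linarith [n.cast_nonneg (α := ℝ)])
      (by push_cast; linarith)).trans hc.2⟩) hnonempty (hcompact 0) fun n => (hcompact n).isClosed
  rw [mem_iInter] at hc
  have hc0 : c ≠ 0 := by
    have := (hc 0).1
    rintro rfl
    simp at this
  refine ⟨V c, U c, t₀, c * β, mul_ne_zero hc0 (by exact_mod_cast hβ.ne'), hVd c, hUd c,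
    fun t ht => ?_, hVU c hc0, ?_⟩
  · obtain ⟨n, hn⟩ := exists_nat_ge (t - t₀)
    exact (hmono c ht (by simp) (by linarith : t ≤ t₀ + n)).trans (hc n).2
  -- Split the real parts into halves. The half carrying `e^{iβt}` contributes `cβ`; the conjugate
  -- half has an oscillating factor of modulus one and a coefficient tending to `β - i · conj (iβ) =
  -- 0`.
  · have hA' := (Complex.continuous_conj.tendsto 1).comp hA
    have hB' := (Complex.continuous_conj.tendsto _).comp hB
    have h1 := (((hA.const_mul (β : ℂ)).sub (hB.const_mul Complex.I)).const_mul c).div_const 2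
    have h2 := (((hA'.const_mul (β : ℂ)).sub (hB'.const_mul Complex.I)).const_mul
      ((starRingEnd ℂ) c)).div_const 2
    have e2 : (starRingEnd ℂ) c * ((β : ℂ) * (starRingEnd ℂ) 1 -
        Complex.I * (starRingEnd ℂ) (Complex.I * β)) / 2 = 0 := by
      simp only [map_one, map_mul, Complex.conj_I, Complex.conj_ofReal]
      linear_combination ((starRingEnd ℂ) c * β / 2) * Complex.I_sq
    rw [e2] at h2
    have h3 : Tendsto (fun t => (starRingEnd ℂ) (e t) ^ 2 * ((starRingEnd ℂ) c *
        ((β : ℂ) * (starRingEnd ℂ) (A t) - Complex.I * (starRingEnd ℂ) (B t)) / 2)) atBot (𝓝 0) := by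
      rw [tendsto_zero_iff_norm_tendsto_zero] at h2 ⊢
      refine h2.congr fun t => ?_
      have : ‖(starRingEnd ℂ) (e t)‖ = 1 := by
        rw [hen, Complex.norm_exp]; simp
      rw [norm_mul, norm_pow, this]
      simp
    have h4 := h1.add h3
    have e1 : c * ((β : ℂ) * 1 - Complex.I * (Complex.I * β)) / 2 + 0 = c * β := by
      linear_combination (-c * β / 2) * Complex.I_sq
    rw [e1] at h4
    refine h4.congr fun t => ?_
    rw [← hen]
    simp only [hV, hU, Complex.re_eq_add_conj, map_mul]
    linear_combination (-(c * (β * A t - Complex.I * B t) / 2)) * hee t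

/-- The quadratic form `v'² + (β² - e^{2t}) v²` of the recessive solution is positive. -/
theorem recessive_form_pos {β t₀ : ℝ} {v w : ℝ → ℝ} (hv : ∀ t, HasDerivAt v (w t) t)
    (hw : ∀ t, HasDerivAt w ((Real.exp (2 * t) - β ^ 2) * v t) t)
    (hvw : ∀ t, t₀ ≤ t → v t * w t ≤ 0) (hne : ∀ t, v t = 0 → w t ≠ 0) (t : ℝ) :
    0 < w t ^ 2 - (Real.exp (2 * t) - β ^ 2) * v t ^ 2 := by
  set N : ℝ → ℝ := fun t => w t ^ 2 - (Real.exp (2 * t) - β ^ 2) * v t ^ 2 with hN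
  have hNd : ∀ t, HasDerivAt N (-(2 * Real.exp (2 * t) * v t ^ 2)) t := fun t => by
    have h1 : HasDerivAt (fun t : ℝ => 2 * t) 2 t := by
      simpa using (hasDerivAt_id t).const_mul (2 : ℝ)
    refine HasDerivAt.congr_deriv (((hw t).pow 2).sub ((h1.exp.sub_const (β ^ 2)).mul
      ((hv t).pow 2))) ?_
    ring
  have hanti : Antitone N := antitone_of_deriv_nonpos (fun t => (hNd t).differentiableAt)
    fun t => by
      rw [(hNd t).deriv]
      nlinarith [mul_nonneg (Real.exp_pos (2 * t)).le (sq_nonneg (v t))]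
  -- If `N s < 0`, then `N r ≤ N s` for `r ≥ s` gives `(v w)' = w² + (e^{2r} - β²) v² ≥ -N s > 0`,
  -- so `v w` grows at least linearly and becomes positive beyond `t₀`.
  have hnn : ∀ s, 0 ≤ N s := by
    intro s
    by_contra! hs
    set T := max s t₀
    have hd : ∀ r, HasDerivAt (fun r => v r * w r - (-N s) * r)
        (w r * w r + v r * ((Real.exp (2 * r) - β ^ 2) * v r) - (-N s)) r := fun r => by
      refine HasDerivAt.congr_deriv (((hv r).mul (hw r)).sub ((hasDerivAt_id r).const_mul (-N s))) ?_
      ring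
    have hm : MonotoneOn (fun r => v r * w r - (-N s) * r) (Ici T) := by
      refine monotoneOn_of_deriv_nonneg (convex_Ici _)
        (fun t _ => (hd t).continuousAt.continuousWithinAt)
        (fun t _ => (hd t).differentiableAt.differentiableWithinAt) fun r hr => ?_
      rw [interior_Ici] at hr
      rw [(hd r).deriv]
      have h1 : N r ≤ N s := hanti ((le_max_left _ _).trans (le_of_lt hr))
      simp only [hN] at h1 ⊢
      nlinarith [sq_nonneg (w r)]
    -- The point where the linear lower bound for `v w` reaches `1`.
    set r := T + (1 - v T * w T) / (-N s) with hr
    have hneg : 0 < -N s := by linarith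
    have hTle : t₀ ≤ T := le_max_right _ _
    have hTr : T ≤ r := by
      have : 0 ≤ (1 - v T * w T) / (-N s) := div_nonneg (by linarith [hvw T hTle]) hneg.le
      linarith
    have h2 := hm self_mem_Ici hTr hTr
    have h3 := hvw r (hTle.trans hTr)
    have h4 : (-N s) * r = (-N s) * T + (1 - v T * w T) := by
      rw [hr, mul_add, mul_div_cancel₀ _ hneg.ne']
    simp only at h2
    linarith
  -- Equality would force `N = 0` from `t` on, hence `v = 0` through `N'`, and then also `w = 0`.
  refine lt_of_le_of_ne (hnn t) fun h0 => ?_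
  have hzero : ∀ s, t ≤ s → N s = 0 := fun s hs =>
    le_antisymm ((hanti hs).trans h0.symm.le) (hnn s)
  have hder : ∀ s, t < s → v s = 0 := fun s hs => by
    have h1 : N =ᶠ[𝓝 s] fun _ => 0 := by
      filter_upwards [Ioi_mem_nhds hs] with r hr using hzero r (le_of_lt hr)
    have h2 := (hNd s).unique ((hasDerivAt_const s (0 : ℝ)).congr_of_eventuallyEq h1)
    have := Real.exp_pos (2 * s)
    have h3 : v s ^ 2 = 0 := by
      rcases mul_eq_zero.1 (neg_eq_zero.1 h2) with h | h
      · linarith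
      · exact h
    exact pow_eq_zero_iff two_ne_zero |>.1 h3
  have h5 : v (t + 1) = 0 := hder _ (by linarith)
  have h6 := hzero (t + 1) (by linarith)
  simp only [hN, h5] at h6
  exact hne _ h5 (by simpa using h6)

/-- Beyond `t₀` the recessive solution has no zero. -/
theorem recessive_ne_zero {t₀ : ℝ} {v w : ℝ → ℝ} (hv : ∀ t, HasDerivAt v (w t) t)
    (hvw : ∀ t, t₀ ≤ t → v t * w t ≤ 0) (hne : ∀ t, v t = 0 → w t ≠ 0) {t : ℝ} (ht : t₀ ≤ t) :
    v t ≠ 0 := by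
  intro h0
  -- Since `(v²)' = 2 v w ≤ 0`, a zero would persist to the right and kill the derivative too.
  have hanti : AntitoneOn (fun s => v s ^ 2) (Ici t₀) := by
    have hd : ∀ s, HasDerivAt (fun s => v s ^ 2) (2 * (v s * w s)) s := fun s => by
      refine HasDerivAt.congr_deriv ((hv s).pow 2) ?_
      ring
    refine antitoneOn_of_deriv_nonpos (convex_Ici _)
      (fun t _ => (hd t).continuousAt.continuousWithinAt)
      (fun t _ => (hd t).differentiableAt.differentiableWithinAt) fun r hr => ?_
    rw [interior_Ici] at hr
    rw [(hd r).deriv]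
    linarith [hvw r (le_of_lt hr)]
  have hz : ∀ s, t ≤ s → v s = 0 := fun s hs => by
    have := hanti ht (ht.trans hs) hs
    simp only [h0] at this
    exact pow_eq_zero_iff two_ne_zero |>.1 (le_antisymm (by simpa using this) (sq_nonneg _))
  have h1 : v =ᶠ[𝓝 (t + 1)] fun _ => 0 := by
    filter_upwards [Ioi_mem_nhds (by linarith : t < t + 1)] with r hr using hz r (le_of_lt hr)
  have h2 := (hv (t + 1)).unique ((hasDerivAt_const (t + 1) (0 : ℝ)).congr_of_eventuallyEq h1)
  exact hne _ (hz _ (by linarith)) h2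

/-! ### The solution regular at the origin. -/

theorem one_le_norm_add_natCast {c : ℝ} (hc : 1 ≤ c) (k : ℕ) : 1 ≤ ‖c + k‖ := by
  have : (0 : ℝ) ≤ k := k.cast_nonneg
  rw [Real.norm_of_nonneg] <;> linarith

theorem hasDerivAt_hypLimit_real {c : ℝ} (hc : 1 ≤ c) (x : ℝ) :
    HasDerivAt (hypLimit c) (hypLimit (c + 1) x / c) x :=
  hasDerivAt_hypLimit (one_le_norm_add_natCast hc) x

/-- Positivity of the quadratic form that makes the logarithmic derivative of the regular
solution increase with the energy parameter. -/
theorem hypLimit_form_pos {c : ℝ} (hc : 1 ≤ c) (z : ℝ) :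
    0 < hypLimit c z ^ 2 - (c - 1) * hypLimit c z * (hypLimit (c + 1) z / c) -
      z * (hypLimit (c + 1) z / c) ^ 2 := by
  have hcn := one_le_norm_add_natCast hc
  have hcn1 := one_le_norm_succ hcn
  have hc0 : 0 < c := by linarith
  set f : ℝ → ℝ := hypLimit c
  set g : ℝ → ℝ := fun y => hypLimit (c + 1) y / c with hg
  set k : ℝ → ℝ := fun y => hypLimit (c + 1 + 1) y / (c + 1) / c
  have hfd : ∀ y, HasDerivAt f (g y) y := hasDerivAt_hypLimit hcn
  have hgd : ∀ y, HasDerivAt g (k y) y := fun y => (hasDerivAt_hypLimit hcn1 y).div_const c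
  have hode : ∀ y, y * k y + c * g y = f y := hypLimit_contiguous hcn
  set H : ℝ → ℝ := fun y => f y ^ 2 - (c - 1) * f y * g y - y * g y ^ 2 with hH
  change 0 < H z
  set H' : ℝ → ℝ := fun y => 2 * f y * g y - (c - 1) * (g y * g y + f y * k y) -
    (g y ^ 2 + y * (2 * g y * k y)) with hH'
  have hHd : ∀ y, HasDerivAt H (H' y) y := fun y => by
    refine HasDerivAt.congr_deriv ((((hfd y).pow 2).sub (((hfd y).const_mul (c - 1)).mul
      (hgd y))).sub ((hasDerivAt_id y).mul ((hgd y).pow 2))) ?_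
    simp only [hH', id]
    ring
  -- Hence `d/dt (t^c H(tz)) = t^{c-1} f(tz)² ≥ 0`. Integrating along the ray from `0`, where `H 0 =
  -- 1/c`, gives positivity for either sign of `z`.
  have hkey : ∀ y, y * H' y + c * H y = f y ^ 2 := fun y => by
    simp only [hH, hH', ← hode y]
    ring
  have hHc : Continuous H := continuous_iff_continuousAt.2 fun y => (hHd y).continuousAt
  have hH0 : 0 < H 0 := by
    have h1 : f 0 = 1 := hypLimit_zero
    have h2 : g 0 = 1 / c := by simp only [hg, hypLimit_zero]
    simp only [hH, h1, h2]
    have : (1 : ℝ) ^ 2 - (c - 1) * 1 * (1 / c) - 0 * (1 / c) ^ 2 = 1 / c := by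
      field_simp; ring
    rw [this]
    positivity
  have hmono : MonotoneOn (fun t : ℝ => t ^ c * H (t * z)) (Ici 0) := by
    have hd : ∀ t : ℝ, 0 < t → HasDerivAt (fun t : ℝ => t ^ c * H (t * z))
        (t ^ (c - 1) * f (t * z) ^ 2) t := fun t ht => by
      have h1 : HasDerivAt (fun t : ℝ => H (t * z)) (H' (t * z) * z) t := by
        have h2 : HasDerivAt (fun t : ℝ => t * z) z t := by
          simpa using (hasDerivAt_id t).mul_const z
        exact (hHd (t * z)).comp t h2
      refine HasDerivAt.congr_deriv ((Real.hasDerivAt_rpow_const (Or.inl ht.ne')).mul h1) ?_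
      rw [← hkey]
      have : t ^ c = t ^ (c - 1) * t := by
        rw [Real.rpow_sub_one ht.ne']; field_simp
      rw [this]
      ring
    refine monotoneOn_of_deriv_nonneg (convex_Ici _) ?_ ?_ ?_
    · refine ContinuousOn.mul (fun t _ => ?_) (hHc.comp (by fun_prop)).continuousOn
      exact (Real.continuousAt_rpow_const _ _ (Or.inr hc0.le)).continuousWithinAt
    · intro t ht
      rw [interior_Ici] at ht
      exact (hd t ht).differentiableAt.differentiableWithinAt
    · intro t ht
      rw [interior_Ici] at ht
      rw [(hd t ht).deriv]
      have : 0 < t := ht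
      positivity
  have hsmall : ∀ᶠ t in 𝓝[>] (0 : ℝ), 0 < H (t * z) := by
    have : Tendsto (fun t : ℝ => H (t * z)) (𝓝[>] 0) (𝓝 (H 0)) := by
      have h1 : Continuous fun t : ℝ => H (t * z) := by fun_prop
      have h2 := h1.tendsto 0
      simp only [zero_mul] at h2
      exact h2.mono_left nhdsWithin_le_nhds
    exact this.eventually (lt_mem_nhds hH0)
  obtain ⟨t, ht, ht1⟩ := (hsmall.and (Ioo_mem_nhdsGT one_pos)).exists
  have h1 := hmono (mem_Ici.2 ht1.1.le) (mem_Ici.2 zero_le_one) ht1.2.le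
  simp only [Real.one_rpow, one_mul] at h1
  exact (mul_pos (Real.rpow_pos_of_pos ht1.1 c) ht).trans_le h1

/-- The solution of `φ'' = (l (l + 1) / r² + q) φ` that is regular at the origin. -/
def regularSolution (l : ℕ) (q r : ℝ) : ℝ :=
  r ^ (l + 1) * hypLimit ((l : ℝ) + 3 / 2) (q * r ^ 2 / 4)

/-- The derivative of `regularSolution`. -/
def regularSolutionDeriv (l : ℕ) (q r : ℝ) : ℝ :=
  r ^ l * ((l + 1) * hypLimit ((l : ℝ) + 3 / 2) (q * r ^ 2 / 4) +
    2 * (q * r ^ 2 / 4) * (hypLimit ((l : ℝ) + 3 / 2 + 1) (q * r ^ 2 / 4) / ((l : ℝ) + 3 / 2)))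

theorem one_le_natCast_add (l : ℕ) : (1 : ℝ) ≤ (l : ℝ) + 3 / 2 := by
  have : (0 : ℝ) ≤ l := l.cast_nonneg
  linarith

theorem hasDerivAt_quadratic_arg (q r : ℝ) :
    HasDerivAt (fun r : ℝ => q * r ^ 2 / 4) (q * r / 2) r := by
  refine HasDerivAt.congr_deriv (((hasDerivAt_pow 2 r).const_mul q).div_const 4) ?_
  push_cast
  ring

theorem hasDerivAt_regularSolution (l : ℕ) (q r : ℝ) :
    HasDerivAt (regularSolution l q) (regularSolutionDeriv l q r) r := by
  have hF : HasDerivAt (fun r => hypLimit ((l : ℝ) + 3 / 2) (q * r ^ 2 / 4))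
      (hypLimit ((l : ℝ) + 3 / 2 + 1) (q * r ^ 2 / 4) / ((l : ℝ) + 3 / 2) * (q * r / 2)) r :=
    HasDerivAt.comp (h₂ := hypLimit ((l : ℝ) + 3 / 2)) r
      (hasDerivAt_hypLimit_real (one_le_natCast_add l) (q * r ^ 2 / 4)) (hasDerivAt_quadratic_arg q r)
  refine HasDerivAt.congr_deriv ((hasDerivAt_pow (l + 1) r).mul hF) ?_
  simp only [regularSolutionDeriv, Nat.add_sub_cancel]
  push_cast
  ring

theorem hasDerivAt_regularSolutionDeriv (l : ℕ) (q : ℝ) {r : ℝ} (hr : r ≠ 0) :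
    HasDerivAt (regularSolutionDeriv l q)
      (((l : ℝ) * (l + 1) / r ^ 2 + q) * regularSolution l q r) r := by
  have hcn := one_le_norm_add_natCast (one_le_natCast_add l)
  have hc1 : (1 : ℝ) ≤ (l : ℝ) + 3 / 2 + 1 := by linarith [one_le_natCast_add l]
  have hx := hasDerivAt_quadratic_arg q r
  have hF : HasDerivAt (fun r => hypLimit ((l : ℝ) + 3 / 2) (q * r ^ 2 / 4))
      (hypLimit ((l : ℝ) + 3 / 2 + 1) (q * r ^ 2 / 4) / ((l : ℝ) + 3 / 2) * (q * r / 2)) r :=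
    HasDerivAt.comp (h₂ := hypLimit ((l : ℝ) + 3 / 2)) r
      (hasDerivAt_hypLimit_real (one_le_natCast_add l) (q * r ^ 2 / 4)) hx
  have hG : HasDerivAt (fun r => hypLimit ((l : ℝ) + 3 / 2 + 1) (q * r ^ 2 / 4) /
      ((l : ℝ) + 3 / 2)) (hypLimit ((l : ℝ) + 3 / 2 + 1 + 1) (q * r ^ 2 / 4) /
      ((l : ℝ) + 3 / 2 + 1) / ((l : ℝ) + 3 / 2) * (q * r / 2)) r := 
    HasDerivAt.comp (h₂ := fun x => hypLimit ((l : ℝ) + 3 / 2 + 1) x / ((l : ℝ) + 3 / 2)) r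
      ((hasDerivAt_hypLimit_real hc1 (q * r ^ 2 / 4)).div_const ((l : ℝ) + 3 / 2)) hx
  refine HasDerivAt.congr_deriv ((hasDerivAt_pow l r).mul
    ((hF.const_mul ((l : ℝ) + 1)).add ((hx.const_mul 2).mul hG))) ?_
  have hode := hypLimit_contiguous hcn (q * r ^ 2 / 4)
  simp only [regularSolution]
  have hl : (l : ℝ) * r ^ (l - 1) = l * r ^ l / r := by
    rcases l with _ | l
    · simp
    · rw [Nat.add_sub_cancel, pow_succ]; field_simp
  have hc0 : (l : ℝ) + 3 / 2 ≠ 0 := by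
    have := one_le_natCast_add l
    linarith
  rw [hl, pow_succ r l]
  rw [← hode]
  generalize hypLimit ((l : ℝ) + 3 / 2 + 1 + 1) (q * r ^ 2 / 4) / ((l : ℝ) + 3 / 2 + 1) /
    ((l : ℝ) + 3 / 2) = K
  generalize hypLimit ((l : ℝ) + 3 / 2 + 1) (q * r ^ 2 / 4) / ((l : ℝ) + 3 / 2) = G
  field_simp
  ring

theorem tendsto_regularSolution (l : ℕ) (q : ℝ) :
    Tendsto (fun r => (r ^ (l + 1))⁻¹ * regularSolution l q r) (𝓝[>] 0) (𝓝 1) := by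
  have hcn := one_le_norm_add_natCast (one_le_natCast_add l)
  have h1 : Tendsto (fun r : ℝ => hypLimit ((l : ℝ) + 3 / 2) (q * r ^ 2 / 4)) (𝓝[>] 0) (𝓝 1) := by
    have h2 : Continuous (hypLimit ((l : ℝ) + 3 / 2)) :=
      continuous_iff_continuousAt.2 fun y => (hasDerivAt_hypLimit hcn y).continuousAt
    have h3 : Continuous fun r : ℝ => hypLimit ((l : ℝ) + 3 / 2) (q * r ^ 2 / 4) := by fun_prop
    have h4 := h3.tendsto 0
    simp only [ne_eq, OfNat.ofNat_ne_zero, not_false_eq_true, zero_pow, mul_zero, zero_div,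
      hypLimit_zero] at h4
    exact h4.mono_left nhdsWithin_le_nhds
  refine h1.congr' ?_
  filter_upwards [self_mem_nhdsWithin] with r hr
  have : r ≠ 0 := ne_of_gt hr
  rw [regularSolution]
  field_simp

/-! ### Wronskians and uniqueness at the origin, at `r₀` and at infinity. -/

/-- The Wronskian of two solutions of `y'' = p y` is constant on an interval. -/
theorem wronskian_const {s : Set ℝ} (hs : IsOpen s) (hs' : IsPreconnected s) {p : ℝ → ℝ}
    {u u₁ y y₁ : ℝ → ℂ} (hu : ∀ r ∈ s, HasDerivAt u (u₁ r) r)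
    (hu₁ : ∀ r ∈ s, HasDerivAt u₁ (p r * u r) r) (hy : ∀ r ∈ s, HasDerivAt y (y₁ r) r)
    (hy₁ : ∀ r ∈ s, HasDerivAt y₁ (p r * y r) r) {a b : ℝ} (ha : a ∈ s) (hb : b ∈ s) :
    u a * y₁ a - u₁ a * y a = u b * y₁ b - u₁ b * y b := by
  have hd : ∀ r ∈ s, HasDerivAt (fun r => u r * y₁ r - u₁ r * y r) 0 r := fun r hr => by
    refine HasDerivAt.congr_deriv
      (((hu r hr).mul (hy₁ r hr)).sub ((hu₁ r hr).mul (hy r hr))) ?_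
    ring
  exact hs.is_const_of_deriv_eq_zero hs'
    (fun r hr => (hd r hr).differentiableAt.differentiableWithinAt)
    (fun r hr => (hd r hr).deriv) ha hb

/-- Two solutions of `y'' = p y` that are both asymptotic to `r ^ (l + 1)` at the origin have
vanishing Wronskian. -/
theorem wronskian_eq_zero_of_normalized {l : ℕ} {r₀ : ℝ} (hr₀ : 0 < r₀) {p : ℝ → ℝ}
    {u u₁ : ℝ → ℂ} {φ φ₁ : ℝ → ℝ} (hu : ∀ r ∈ Ioo 0 r₀, HasDerivAt u (u₁ r) r)
    (hu₁ : ∀ r ∈ Ioo 0 r₀, HasDerivAt u₁ (p r * u r) r)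
    (hφ : ∀ r ∈ Ioo 0 r₀, HasDerivAt φ (φ₁ r) r)
    (hφ₁ : ∀ r ∈ Ioo 0 r₀, HasDerivAt φ₁ (p r * φ r) r)
    (hun : Tendsto (fun r : ℝ => (r ^ (l + 1))⁻¹ • u r) (𝓝[>] 0) (𝓝 1))
    (hφn : Tendsto (fun r : ℝ => (r ^ (l + 1))⁻¹ * φ r) (𝓝[>] 0) (𝓝 1)) {r : ℝ}
    (hr : r ∈ Ioo 0 r₀) : u r * φ₁ r - u₁ r * φ r = 0 := by
  by_contra hC
  set C := u r * φ₁ r - u₁ r * φ r with hCdef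
  have hW : ∀ s ∈ Ioo 0 r₀, u s * φ₁ s - u₁ s * φ s = C := fun s hs =>
    wronskian_const isOpen_Ioo isPreconnected_Ioo hu hu₁
      (fun r hr => (hφ r hr).ofReal_comp)
      (fun r hr => ((hφ₁ r hr).ofReal_comp).congr_deriv (by push_cast; rfl)) hs hr
  have hev : ∀ᶠ s in 𝓝[>] (0 : ℝ), (s ^ (l + 1))⁻¹ * φ s ∈ Ioo (0 : ℝ) 2 ∧ s ∈ Ioo 0 (min r₀ 1) :=
    (hφn.eventually (Ioo_mem_nhds one_pos one_lt_two)).and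
      (Ioo_mem_nhdsGT (lt_min hr₀ one_pos))
  obtain ⟨δ, hδ, hδs⟩ := mem_nhdsGT_iff_exists_Ioo_subset.1 hev
  have hb : ∀ s ∈ Ioo 0 δ, 0 < φ s ∧ φ s ≤ 2 * s ∧ s ∈ Ioo 0 r₀ := fun s hs => by
    obtain ⟨h1, h2⟩ := hδs hs
    have hs0 : 0 < s := hs.1
    have hp : 0 < s ^ (l + 1) := by positivity
    have he : φ s = s ^ (l + 1) * ((s ^ (l + 1))⁻¹ * φ s) := by field_simp
    refine ⟨?_, ?_, h2.1, h2.2.trans_le (min_le_left _ _)⟩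
    · rw [he]; exact mul_pos hp h1.1
    · have h3 : s ^ (l + 1) ≤ s := by
        have := pow_le_pow_of_le_one hs0.le (h2.2.trans_le (min_le_right _ _)).le
          (Nat.le_add_left 1 l)
        rwa [pow_one] at this
      rw [he]
      nlinarith [h1.1, h1.2]
  -- A nonzero Wronskian `C` gives `(-u/(Cφ))' = 1/φ² ≥ 1/(4s²)`, because `0 < φ ≤ 2s` near `0`. So
  -- `h` is nondecreasing; but `u/φ → 1` makes it tend to `+∞` at `0`, which is absurd.
  set h : ℝ → ℝ := fun s => (-(u s / φ s) / C).re + (4 * s)⁻¹ with hh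
  have hd : ∀ s ∈ Ioo 0 δ, HasDerivAt h (1 / φ s ^ 2 - 1 / (4 * s ^ 2)) s := fun s hs => by
    obtain ⟨h1, h2, h3⟩ := hb s hs
    have hne : (φ s : ℂ) ≠ 0 := by exact_mod_cast h1.ne'
    have d1 : HasDerivAt (fun s => -(u s / φ s) / C) ((1 / φ s ^ 2 : ℝ) : ℂ) s := by
      refine HasDerivAt.congr_deriv
        ((((hu s h3).div ((hφ s h3).ofReal_comp) hne).neg).div_const C) ?_
      have := hW s h3
      push_cast
      field_simp
      linear_combination this
    have d2 : HasDerivAt (fun s => (-(u s / φ s) / C).re) (1 / φ s ^ 2) s :=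
      Complex.reCLM.hasFDerivAt.comp_hasDerivAt s d1
    have hs0 : s ≠ 0 := ne_of_gt hs.1
    have d3 : HasDerivAt (fun s : ℝ => (4 * s)⁻¹) (-(1 / (4 * s ^ 2))) s := by
      have := ((hasDerivAt_id s).const_mul 4).inv (by simpa using hs0)
      refine HasDerivAt.congr_deriv this ?_
      simp only [id]
      field_simp
    exact (d2.add d3).congr_deriv (by ring)
  have hmono : MonotoneOn h (Ioo 0 δ) := by
    refine monotoneOn_of_deriv_nonneg (convex_Ioo _ _)
      (fun s hs => (hd s hs).continuousAt.continuousWithinAt) ?_ ?_ <;> rw [interior_Ioo]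
    · exact fun s hs => (hd s hs).differentiableAt.differentiableWithinAt
    · intro s hs
      rw [(hd s hs).deriv, sub_nonneg]
      obtain ⟨h1, h2, -⟩ := hb s hs
      have : φ s ^ 2 ≤ 4 * s ^ 2 := by nlinarith
      exact one_div_le_one_div_of_le (by positivity) this
  have hlim : Tendsto (fun s => (-(u s / φ s) / C).re) (𝓝[>] 0) (𝓝 (-1 / C).re) := by
    have hφc : Tendsto (fun s : ℝ => (((s ^ (l + 1))⁻¹ * φ s : ℝ) : ℂ)) (𝓝[>] 0) (𝓝 1) := by
      have := (Complex.continuous_ofReal.tendsto 1).comp hφn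
      rwa [Complex.ofReal_one] at this
    have h1 := (Complex.continuous_re.tendsto _).comp
      ((hun.div hφc one_ne_zero).neg.div_const C)
    rw [div_one] at h1
    refine h1.congr' ?_
    filter_upwards [self_mem_nhdsWithin] with s hs
    have hs0 : (s : ℂ) ≠ 0 := by exact_mod_cast ne_of_gt hs
    have hs1 : ((s : ℂ) ^ (l + 1))⁻¹ ≠ 0 := inv_ne_zero (pow_ne_zero _ hs0)
    simp only [Function.comp_apply, Complex.real_smul, Complex.ofReal_mul, Complex.ofReal_inv,
      Complex.ofReal_pow, Pi.div_apply]
    rw [mul_div_mul_left _ _ hs1]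
  have htop : Tendsto h (𝓝[>] 0) atTop := by
    refine hlim.add_atTop ?_
    have h4 : Tendsto (fun s : ℝ => 4 * s) (𝓝[>] 0) (𝓝[>] 0) := by
      refine tendsto_nhdsWithin_iff.2 ⟨?_, ?_⟩
      · have : Tendsto (fun s : ℝ => 4 * s) (𝓝 0) (𝓝 (4 * 0)) :=
          (continuous_const.mul continuous_id).tendsto 0
        rw [mul_zero] at this
        exact this.mono_left nhdsWithin_le_nhds
      · filter_upwards [self_mem_nhdsWithin] with s hs
        have : (0 : ℝ) < s := hs
        simpa using this
    exact tendsto_inv_nhdsGT_zero.comp h4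
  have hδ0 : 0 < δ := hδ
  have hδ2 : δ / 2 ∈ Ioo 0 δ := ⟨by linarith, by linarith⟩
  obtain ⟨s, hs1, hs2⟩ := ((htop.eventually (eventually_gt_atTop (h (δ / 2)))).and
    (Ioo_mem_nhdsGT hδ2.1)).exists
  exact absurd (hmono ⟨hs2.1, hs2.2.trans hδ2.2⟩ hδ2 hs2.2.le) (not_le.2 hs1)

/-- Backward uniqueness for `y'' = p y` with bounded `p`. -/
theorem eq_zero_of_cauchy_data_eq_zero {δ r₀ K : ℝ} (hδ : δ < r₀) {p : ℝ → ℝ} {y y₁ : ℝ → ℂ}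
    (hp : ∀ r ∈ Ioo δ r₀, |p r| ≤ K) (hyc : ContinuousOn y (Icc δ r₀))
    (hy₁c : ContinuousOn y₁ (Icc δ r₀)) (hy : ∀ r ∈ Ioo δ r₀, HasDerivAt y (y₁ r) r)
    (hy₁ : ∀ r ∈ Ioo δ r₀, HasDerivAt y₁ (p r * y r) r) (h0 : y r₀ = 0) (h1 : y₁ r₀ = 0) :
    y δ = 0 := by
  -- The exponential weight beats the growth of the energy: `2|⟨y, y₁⟩| + 2|⟨y₁, p y⟩| ≤ (1 +
  -- K)(‖y‖² + ‖y₁‖²)`. So `e` is nondecreasing, and it vanishes at `r₀`.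
  set e : ℝ → ℝ := fun r => (‖y r‖ ^ 2 + ‖y₁ r‖ ^ 2) * Real.exp ((1 + K) * r) with he
  have hd : ∀ r ∈ Ioo δ r₀, HasDerivAt e ((2 * inner ℝ (y r) (y₁ r) +
      2 * inner ℝ (y₁ r) (p r * y r)) * Real.exp ((1 + K) * r) +
      (‖y r‖ ^ 2 + ‖y₁ r‖ ^ 2) * (Real.exp ((1 + K) * r) * (1 + K))) r := fun r hr => by
    have h2 : HasDerivAt (fun r : ℝ => (1 + K) * r) (1 + K) r := by
      simpa using (hasDerivAt_id r).const_mul (1 + K)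
    exact (((hy r hr).norm_sq).add ((hy₁ r hr).norm_sq)).mul h2.exp
  have hmono : MonotoneOn e (Icc δ r₀) := by
    refine monotoneOn_of_deriv_nonneg (convex_Icc _ _)
      (((hyc.norm.pow 2).add (hy₁c.norm.pow 2)).mul (by fun_prop)) ?_ ?_ <;> rw [interior_Icc]
    · exact fun r hr => (hd r hr).differentiableAt.differentiableWithinAt
    · intro r hr
      rw [(hd r hr).deriv]
      have a1 := neg_le_of_abs_le (abs_real_inner_le_norm (y r) (y₁ r))
      have a2 := neg_le_of_abs_le (abs_real_inner_le_norm (y₁ r) (p r * y r))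
      have a3 : ‖(p r : ℂ) * y r‖ ≤ K * ‖y r‖ := by
        rw [norm_mul, Complex.norm_real, Real.norm_eq_abs]
        exact mul_le_mul_of_nonneg_right (hp r hr) (norm_nonneg _)
      have a4 : ‖y₁ r‖ * ‖(p r : ℂ) * y r‖ ≤ ‖y₁ r‖ * (K * ‖y r‖) :=
        mul_le_mul_of_nonneg_left a3 (norm_nonneg _)
      have hK : 0 ≤ K := (abs_nonneg _).trans (hp r hr)
      have a5 : 0 ≤ (1 + K) * (‖y r‖ - ‖y₁ r‖) ^ 2 := by positivity
      have a6 : 0 ≤ 2 * inner ℝ (y r) (y₁ r) + 2 * inner ℝ (y₁ r) (p r * y r) +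
          (‖y r‖ ^ 2 + ‖y₁ r‖ ^ 2) * (1 + K) := by nlinarith
      have := mul_nonneg a6 (Real.exp_pos ((1 + K) * r)).le
      linarith
  have h2 := hmono (left_mem_Icc.2 hδ.le) (right_mem_Icc.2 hδ.le) hδ.le
  simp only [he, h0, h1, norm_zero] at h2
  have h3 := Real.exp_pos ((1 + K) * δ)
  have h4 : ‖y δ‖ ^ 2 + ‖y₁ δ‖ ^ 2 ≤ 0 := by
    by_contra! hc
    have := mul_pos hc h3
    norm_num at h2
    linarith
  have h5 : ‖y δ‖ ^ 2 = 0 := le_antisymm (by nlinarith [sq_nonneg ‖y₁ δ‖]) (sq_nonneg _)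
  simpa using h5

/-- Two square-integrable solutions of `y'' = p y`, with `p` eventually nonnegative, have vanishing
Wronskian. -/
theorem wronskian_eq_zero_of_memLp {r₀ R : ℝ} (hR : r₀ < R) {p : ℝ → ℝ} {u u₁ y y₁ : ℝ → ℂ}
    (hp : ∀ r, R ≤ r → 0 ≤ p r) (hu : ∀ r ∈ Ioi r₀, HasDerivAt u (u₁ r) r)
    (hu₁ : ∀ r ∈ Ioi r₀, HasDerivAt u₁ (p r * u r) r) (hy : ∀ r ∈ Ioi r₀, HasDerivAt y (y₁ r) r)
    (hy₁ : ∀ r ∈ Ioi r₀, HasDerivAt y₁ (p r * y r) r)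
    (huL : MemLp u 2 (volume.restrict (Ioi r₀))) (hyL : MemLp y 2 (volume.restrict (Ioi r₀)))
    {r : ℝ} (hr : r₀ < r) : u r * y₁ r - u₁ r * y r = 0 := by
  rw [wronskian_const isOpen_Ioi isPreconnected_Ioi hu hu₁ hy hy₁ (mem_Ioi.2 hr) (mem_Ioi.2 hR)]
  by_contra hW
  set W := u R * y₁ R - u₁ R * y R with hWdef
  -- If `W ≠ 0`, Cramer's rule gives a square-integrable combination `z` with `z = z' = 1` at `R`.
  -- Where `p ≥ 0` its norm cannot decrease, so `‖z‖ ≥ 1` on `[R, ∞)`.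
  set α := (y₁ R - y R) / W with hα
  set γ := (u R - u₁ R) / W with hγ
  set z : ℝ → ℂ := fun r => α * u r + γ * y r with hz
  set z₁ : ℝ → ℂ := fun r => α * u₁ r + γ * y₁ r with hz₁
  have hzR : z R = 1 := by
    simp only [hz, hα, hγ]
    field_simp
    rw [hWdef]
    ring
  have hz₁R : z₁ R = 1 := by
    simp only [hz₁, hα, hγ]
    field_simp
    rw [hWdef]
    ring
  have hzd : ∀ r ∈ Ioi r₀, HasDerivAt z (z₁ r) r := fun r hr =>
    ((hu r hr).const_mul α).add ((hy r hr).const_mul γ)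
  have hz₁d : ∀ r ∈ Ioi r₀, HasDerivAt z₁ (p r * z r) r := fun r hr => by
    refine HasDerivAt.congr_deriv (((hu₁ r hr).const_mul α).add ((hy₁ r hr).const_mul γ)) ?_
    simp only [hz]
    ring
  have hzL : MemLp z 2 (volume.restrict (Ioi r₀)) := (huL.const_mul α).add (hyL.const_mul γ)
  have hkd : ∀ r ∈ Ioi r₀, HasDerivAt (fun r => (inner ℝ (z r) (z₁ r) : ℝ))
      (p r * ‖z r‖ ^ 2 + ‖z₁ r‖ ^ 2) r := fun r hr => by
    refine HasDerivAt.congr_deriv ((hzd r hr).inner ℝ (hz₁d r hr)) ?_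
    rw [real_inner_self_eq_norm_sq, ← Complex.real_smul, real_inner_smul_right,
      real_inner_self_eq_norm_sq]
  have hsub : Ici R ⊆ Ioi r₀ := fun r hr => hR.trans_le hr
  have hk : MonotoneOn (fun r => (inner ℝ (z r) (z₁ r) : ℝ)) (Ici R) := by
    refine monotoneOn_of_deriv_nonneg (convex_Ici _)
      (fun s hs => (hkd s (hsub hs)).continuousAt.continuousWithinAt) ?_ ?_ <;> rw [interior_Ici]
    · exact fun s hs => (hkd s (hR.trans hs)).differentiableAt.differentiableWithinAt
    · intro s hs
      rw [(hkd s (hR.trans hs)).deriv]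
      have := hp s (le_of_lt hs)
      positivity
  have hnd : ∀ r ∈ Ioi r₀, HasDerivAt (fun r => ‖z r‖ ^ 2) (2 * inner ℝ (z r) (z₁ r)) r :=
    fun r hr => (hzd r hr).norm_sq
  have hn : MonotoneOn (fun r => ‖z r‖ ^ 2) (Ici R) := by
    refine monotoneOn_of_deriv_nonneg (convex_Ici _)
      (fun s hs => (hnd s (hsub hs)).continuousAt.continuousWithinAt) ?_ ?_ <;> rw [interior_Ici]
    · exact fun s hs => (hnd s (hR.trans hs)).differentiableAt.differentiableWithinAt
    · intro s hs
      rw [(hnd s (hR.trans hs)).deriv]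
      have h1 := hk self_mem_Ici (mem_Ici.2 (le_of_lt hs)) (le_of_lt hs)
      simp only [hzR, hz₁R] at h1
      rw [real_inner_self_eq_norm_sq, norm_one] at h1
      linarith
  have h1 : IntegrableOn (fun r => ‖z r‖ ^ 2) (Ioi R) :=
    ((memLp_two_iff_integrable_sq_norm hzL.1).1 hzL).mono_measure
      (Measure.restrict_mono (Ioi_subset_Ioi hR.le) le_rfl)
  have h2 : IntegrableOn (fun _ : ℝ => (1 : ℝ)) (Ioi R) := by
    refine h1.mono' aestronglyMeasurable_const ?_
    filter_upwards [ae_restrict_mem measurableSet_Ioi] with s hs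
    have := hn self_mem_Ici (mem_Ici.2 (le_of_lt hs)) (le_of_lt hs)
    simp only [hzR, norm_one] at this
    simpa using this
  rw [integrableOn_const_iff] at h2
  simp at h2

/-! ### From the logarithmic variable back to the radius. -/

theorem exp_two_mul_log {x : ℝ} (hx : 0 < x) : Real.exp (2 * Real.log x) = x ^ 2 := by
  rw [mul_comm, Real.exp_mul, Real.exp_log hx]
  norm_num

/-- A solution in the logarithmic variable gives a solution of
`ψ'' = (κ² - (β² + 1/4) / r²) ψ`. -/
theorem hasDerivAt_sqrt_mul_comp_log {v w : ℝ → ℝ} (hv : ∀ t, HasDerivAt v (w t) t) {κ r : ℝ}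
    (hκ : 0 < κ) (hr : 0 < r) :
    HasDerivAt (fun r => √r * v (Real.log (κ * r)))
      ((v (Real.log (κ * r)) / 2 + w (Real.log (κ * r))) / √r) r := by
  have hlog : HasDerivAt (fun r => Real.log (κ * r)) (1 / r) r := by
    refine HasDerivAt.congr_deriv (((hasDerivAt_id r).const_mul κ).log
      (by simpa using ⟨hκ.ne', hr.ne'⟩)) ?_
    simp only [id]
    field_simp
  refine HasDerivAt.congr_deriv ((Real.hasDerivAt_sqrt hr.ne').mul
    (HasDerivAt.comp (h₂ := v) r (hv _) hlog)) ?_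
  have hs := Real.sqrt_pos.2 hr
  have hss := Real.sq_sqrt hr.le
  field_simp
  rw [hss]
  field_simp

/-- Second half of the change of variables: `e^{2 log(κr)} = κ²r²` produces the energy term, and the
factor `√r` adds the `1/4`. -/
theorem hasDerivAt_div_sqrt_comp_log {β : ℝ} {v w : ℝ → ℝ} (hv : ∀ t, HasDerivAt v (w t) t)
    (hw : ∀ t, HasDerivAt w ((Real.exp (2 * t) - β ^ 2) * v t) t) {κ r : ℝ} (hκ : 0 < κ)
    (hr : 0 < r) :
    HasDerivAt (fun r => (v (Real.log (κ * r)) / 2 + w (Real.log (κ * r))) / √r)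
      ((κ ^ 2 - (β ^ 2 + 1 / 4) / r ^ 2) * (√r * v (Real.log (κ * r)))) r := by
  have hlog : HasDerivAt (fun r => Real.log (κ * r)) (1 / r) r := by
    refine HasDerivAt.congr_deriv (((hasDerivAt_id r).const_mul κ).log
      (by simpa using ⟨hκ.ne', hr.ne'⟩)) ?_
    simp only [id]
    field_simp
  have hs := Real.sqrt_pos.2 hr
  refine HasDerivAt.congr_deriv ((((HasDerivAt.comp (h₂ := v) r (hv _) hlog).div_const 2).add
    (HasDerivAt.comp (h₂ := w) r (hw _) hlog)).div (Real.hasDerivAt_sqrt hr.ne') hs.ne') ?_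
  simp only [Function.comp_apply, Pi.add_apply]
  rw [exp_two_mul_log (mul_pos hκ hr)]
  have hss := Real.sq_sqrt hr.le
  generalize v (Real.log (κ * r)) = a
  generalize w (Real.log (κ * r)) = b
  generalize √r = s at hs hss
  subst hss
  field_simp
  ring

/-- Square integrability of the recessive solution. -/
theorem memLp_sqrt_mul_comp_log {β t₀ : ℝ} {v w : ℝ → ℝ} (hv : ∀ t, HasDerivAt v (w t) t)
    (hw : ∀ t, HasDerivAt w ((Real.exp (2 * t) - β ^ 2) * v t) t)
    (hvw : ∀ t, t₀ ≤ t → v t * w t ≤ 0) {κ r₀ : ℝ} (hκ : 0 < κ) (hr₀ : 0 < r₀) :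
    MemLp (fun r => √r * v (Real.log (κ * r))) 2 (volume.restrict (Ioi r₀)) := by
  have hcont : ContinuousOn (fun r => √r * v (Real.log (κ * r))) (Ioi 0) := fun r hr =>
    (hasDerivAt_sqrt_mul_comp_log hv hκ hr).continuousAt.continuousWithinAt
  have hmeas : AEStronglyMeasurable (fun r => √r * v (Real.log (κ * r)))
      (volume.restrict (Ioi r₀)) :=
    (hcont.mono (Ioi_subset_Ioi hr₀.le)).aestronglyMeasurable measurableSet_Ioi
  rw [memLp_two_iff_integrable_sq hmeas]
  -- Beyond `r₁` both `v w ≤ 0` and `κ²r² ≥ 2β²` are available.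
  set r₁ := max r₀ (max (Real.exp t₀ / κ) (2 * |β| / κ)) with hr₁
  have hr01 : r₀ ≤ r₁ := le_max_left _ _
  have hbig : ∀ r, r₁ ≤ r → t₀ ≤ Real.log (κ * r) ∧ 2 * β ^ 2 ≤ κ ^ 2 * r ^ 2 := fun r hr => by
    have h1 : Real.exp t₀ / κ ≤ r := ((le_max_left _ _).trans (le_max_right _ _)).trans hr
    have h2 : 2 * |β| / κ ≤ r := ((le_max_right _ _).trans (le_max_right _ _)).trans hr
    rw [div_le_iff₀' hκ] at h1 h2
    refine ⟨?_, ?_⟩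
    · rwa [Real.le_log_iff_exp_le (mul_pos hκ (hr₀.trans_le (hr01.trans hr)))]
    · have h3 : (2 * |β|) ^ 2 ≤ (κ * r) ^ 2 := pow_le_pow_left₀ (by positivity) h2 2
      rw [mul_pow, sq_abs, mul_pow] at h3
      nlinarith [sq_nonneg β]
  change IntegrableOn (fun r => (√r * v (Real.log (κ * r))) ^ 2) (Ioi r₀)
  rw [← Ioc_union_Ioi_eq_Ioi hr01]
  refine IntegrableOn.union ?_ ?_
  · refine (ContinuousOn.integrableOn_Icc ?_).mono_set Ioc_subset_Icc_self
    exact (hcont.mono fun r hr => hr₀.trans_le hr.1).pow 2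
  -- Here `g` is monotone and bounded above by `0`, so `g'` is integrable; it dominates `κ²/2` times
  -- the squared solution.
  · set g : ℝ → ℝ := fun r => v (Real.log (κ * r)) * w (Real.log (κ * r)) with hg
    set g' : ℝ → ℝ := fun r => (w (Real.log (κ * r)) ^ 2 +
      (κ ^ 2 * r ^ 2 - β ^ 2) * v (Real.log (κ * r)) ^ 2) / r with hg'
    have hgd : ∀ r, 0 < r → HasDerivAt g (g' r) r := fun r hr => by
      have hlog : HasDerivAt (fun r => Real.log (κ * r)) (1 / r) r := by
        refine HasDerivAt.congr_deriv (((hasDerivAt_id r).const_mul κ).log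
          (by simpa using ⟨hκ.ne', hr.ne'⟩)) ?_
        simp only [id]
        field_simp
      refine HasDerivAt.congr_deriv ((HasDerivAt.comp (h₂ := v) r (hv _) hlog).mul
        (HasDerivAt.comp (h₂ := w) r (hw _) hlog)) ?_
      simp only [hg', Function.comp_apply]
      rw [exp_two_mul_log (mul_pos hκ hr)]
      field_simp
    have hlow : ∀ r, r₁ ≤ r → κ ^ 2 / 2 * (√r * v (Real.log (κ * r))) ^ 2 ≤ g' r := fun r hr => by
      have hr0 : 0 < r := hr₀.trans_le (hr01.trans hr)
      have h1 := (hbig r hr).2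
      simp only [hg']
      rw [le_div_iff₀ hr0, mul_pow, Real.sq_sqrt hr0.le]
      nlinarith [sq_nonneg (w (Real.log (κ * r))), mul_nonneg (sub_nonneg.2 h1)
        (sq_nonneg (v (Real.log (κ * r))))]
    have hpos : ∀ r, r₁ ≤ r → 0 ≤ g' r := fun r hr => le_trans (by positivity) (hlow r hr)
    have hr10 : 0 < r₁ := hr₀.trans_le hr01
    have hmono : MonotoneOn g (Ici r₁) := by
      refine monotoneOn_of_deriv_nonneg (convex_Ici _)
        (fun s hs => (hgd s (hr10.trans_le hs)).continuousAt.continuousWithinAt) ?_ ?_ <;>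
        rw [interior_Ici]
      · exact fun s hs => (hgd s (hr10.trans hs)).differentiableAt.differentiableWithinAt
      · intro s hs
        rw [(hgd s (hr10.trans hs)).deriv]
        exact hpos s (le_of_lt hs)
    have hlim : ∃ L, Tendsto g atTop (𝓝 L) := by
      have hm : Monotone fun r => g (max r r₁) := fun a b hab =>
        hmono (mem_Ici.2 (le_max_right _ _)) (mem_Ici.2 (le_max_right _ _)) (max_le_max_right _ hab)
      have hb : BddAbove (range fun r => g (max r r₁)) := ⟨0, by
        rintro _ ⟨r, rfl⟩
        exact hvw _ (hbig _ (le_max_right _ _)).1⟩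
      refine ⟨_, (tendsto_atTop_ciSup hm hb).congr' ?_⟩
      filter_upwards [eventually_ge_atTop r₁] with r hr
      rw [max_eq_left hr]
    obtain ⟨L, hL⟩ := hlim
    have hint := integrableOn_Ioi_deriv_of_nonneg (hgd r₁ hr10).continuousAt.continuousWithinAt
      (fun r hr => hgd r (hr10.trans hr)) (fun r hr => hpos r (le_of_lt hr)) hL
    refine (hint.const_mul (2 / κ ^ 2)).mono' ?_ ?_
    · exact ((hcont.mono (Ioi_subset_Ioi hr10.le)).pow 2).aestronglyMeasurable measurableSet_Ioi
    · filter_upwards [ae_restrict_mem measurableSet_Ioi] with r hr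
      rw [Real.norm_of_nonneg (sq_nonneg _), div_mul_eq_mul_div, le_div_iff₀ (by positivity)]
      have := hlow r (le_of_lt hr)
      linarith

/-! ### Eigenvalues as zeros of a Wronskian at `r₀`. -/

/-- Gluing two differentiable functions with matching values and derivatives. -/
theorem hasDerivAt_ite_le {f g f' g' : ℝ → ℝ} {a r : ℝ} (hf : r ≤ a → HasDerivAt f (f' r) r)
    (hg : a ≤ r → HasDerivAt g (g' r) r) (h : f a = g a) (h' : f' a = g' a) :
    HasDerivAt (fun x => if x ≤ a then f x else g x) (if r ≤ a then f' r else g' r) r := by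
  rcases lt_trichotomy r a with hr | rfl | hr
  · rw [if_pos hr.le]
    refine (hf hr.le).congr_of_eventuallyEq ?_
    filter_upwards [Iio_mem_nhds hr] with x hx
    rw [if_pos (le_of_lt hx)]
  · rw [if_pos le_rfl]
    have h1 : HasDerivWithinAt (fun x => if x ≤ r then f x else g x) (f' r) (Iic r) r :=
      (hf le_rfl).hasDerivWithinAt.congr (fun x hx => if_pos hx) (if_pos le_rfl)
    have h2 : HasDerivWithinAt (fun x => if x ≤ r then f x else g x) (f' r) (Ici r) r := by
      rw [h']
      refine (hg le_rfl).hasDerivWithinAt.congr (fun x hx => ?_) (by rw [if_pos le_rfl, h])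
      rcases eq_or_lt_of_le (mem_Ici.1 hx) with rfl | hx
      · rw [if_pos le_rfl, h]
      · rw [if_neg (not_le.2 hx)]
    have := h1.union h2
    rwa [Iic_union_Ici, hasDerivWithinAt_univ] at this
  · rw [if_neg (not_le.2 hr)]
    refine (hg hr.le).congr_of_eventuallyEq ?_
    filter_upwards [Ioi_mem_nhds hr] with x hx
    rw [if_neg (not_le.2 hx)]

section matching
variable {ε : ℝ} {l : ℕ} {Λ r₀ κ t₀ : ℝ} {v w : ℝ → ℝ}

/-- The coefficient of the radial equation `u'' = p u` at energy `-ε² κ²`. -/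
def radialCoeff (ε : ℝ) (l : ℕ) (Λ r₀ κ r : ℝ) : ℝ :=
  (l : ℝ) * (l + 1) / r ^ 2 + (auxPotential Λ r₀ r + ε ^ 2 * κ ^ 2) / ε ^ 2

theorem radialCoeff_of_le (hε : 0 < ε) {r : ℝ} (hr : r ≤ r₀) :
    radialCoeff ε l Λ r₀ κ r = (l : ℝ) * (l + 1) / r ^ 2 + (Λ / ε ^ 2 + κ ^ 2) := by
  rw [radialCoeff, auxPotential, if_pos hr]
  field_simp

theorem radialCoeff_of_lt (hε : 0 < ε) (hβ : 0 < efimovBetaSq ε l) {r : ℝ} (hr : r₀ < r)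
    (hr0 : 0 < r) :
    radialCoeff ε l Λ r₀ κ r = κ ^ 2 - (efimovBeta ε l ^ 2 + 1 / 4) / r ^ 2 := by
  rw [radialCoeff, auxPotential, if_neg (not_le.2 hr), efimovBeta, Real.sq_sqrt hβ.le,
    efimovBetaSq]
  field_simp
  ring

theorem radial_equation_iff (hε : 0 < ε) (r : ℝ) (u u₂ : ℂ) :
    -(ε ^ 2) • (u₂ - ((l : ℝ) * (l + 1) / r ^ 2) • u) + auxPotential Λ r₀ r • u =
      (-(ε ^ 2 * κ ^ 2)) • u ↔ u₂ = radialCoeff ε l Λ r₀ κ r * u := by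
  have hε' : (ε : ℂ) ≠ 0 := by exact_mod_cast hε.ne'
  have h1 : (radialCoeff ε l Λ r₀ κ r : ℂ) = ((l : ℝ) * (l + 1) / r ^ 2 : ℝ) +
      (auxPotential Λ r₀ r + (ε : ℂ) ^ 2 * κ ^ 2) / ε ^ 2 := by
    rw [radialCoeff]; push_cast; ring
  rw [h1]
  simp only [Complex.real_smul]
  generalize (((l : ℝ) * (l + 1) / r ^ 2 : ℝ) : ℂ) = m
  generalize (auxPotential Λ r₀ r : ℂ) = V
  push_cast
  constructor
  · intro h
    field_simp
    linear_combination -h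
  · rintro rfl
    field_simp
    ring

theorem hasDerivAt_regularSolutionDeriv_radial (hε : 0 < ε) {r : ℝ} (hr : r ∈ Ioo 0 r₀) :
    HasDerivAt (regularSolutionDeriv l (Λ / ε ^ 2 + κ ^ 2))
      (radialCoeff ε l Λ r₀ κ r * regularSolution l (Λ / ε ^ 2 + κ ^ 2) r) r := by
  rw [radialCoeff_of_le hε hr.2.le]
  exact hasDerivAt_regularSolutionDeriv l _ hr.1.ne'

/-- The eigenfunction has zero Wronskian with the regular solution inside and with the recessive one
outside. Its Cauchy data at `r₀` are nonzero, so the data of those two solutions are both parallel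
to it. -/
theorem wronskian_eq_zero_of_isAuxEigenvalue (hε : 0 < ε) (hβ : 0 < efimovBetaSq ε l)
    (hr₀ : 0 < r₀) (hκ : 0 < κ) (hv : ∀ t, HasDerivAt v (w t) t)
    (hw : ∀ t, HasDerivAt w ((Real.exp (2 * t) - efimovBeta ε l ^ 2) * v t) t)
    (hvw : ∀ t, t₀ ≤ t → v t * w t ≤ 0)
    (h : IsAuxEigenvalue ε l Λ r₀ (-(ε ^ 2 * κ ^ 2))) :
    regularSolution l (Λ / ε ^ 2 + κ ^ 2) r₀ *
        ((v (Real.log (κ * r₀)) / 2 + w (Real.log (κ * r₀))) / √r₀) -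
      regularSolutionDeriv l (Λ / ε ^ 2 + κ ^ 2) r₀ * (√r₀ * v (Real.log (κ * r₀))) = 0 := by
  obtain ⟨u, hu⟩ := h
  set φ := regularSolution l (Λ / ε ^ 2 + κ ^ 2) with hφ
  set φ₁ := regularSolutionDeriv l (Λ / ε ^ 2 + κ ^ 2) with hφ₁
  set ψ : ℝ → ℝ := fun r => √r * v (Real.log (κ * r)) with hψ
  set ψ₁ : ℝ → ℝ := fun r => (v (Real.log (κ * r)) / 2 + w (Real.log (κ * r))) / √r with hψ₁
  set p := radialCoeff ε l Λ r₀ κ with hp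
  change φ r₀ * ψ₁ r₀ - φ₁ r₀ * ψ r₀ = 0
  have hud : ∀ r, 0 < r → HasDerivAt u (deriv u r) r := fun r hr =>
    ((hu.contDiffOn.differentiableOn one_ne_zero).differentiableAt (Ioi_mem_nhds hr)).hasDerivAt
  have hu₁c : ContinuousOn (deriv u) (Ioi 0) :=
    hu.contDiffOn.continuousOn_deriv_of_isOpen isOpen_Ioi le_rfl
  have huc : ContinuousOn u (Ioi 0) := hu.contDiffOn.continuousOn
  have hu₁d : ∀ r, 0 < r → r ≠ r₀ → HasDerivAt (deriv u) (p r * u r) r := fun r hr hne => by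
    rw [← (radial_equation_iff hε r (u r) (deriv (deriv u) r)).1 (hu.equation r hr hne)]
    exact (hu.differentiableAt_deriv r hr hne).hasDerivAt
  have hφd : ∀ r, HasDerivAt φ (φ₁ r) r := hasDerivAt_regularSolution l _
  have hφ₁d : ∀ r ∈ Ioo 0 r₀, HasDerivAt φ₁ (p r * φ r) r := fun r hr =>
    hasDerivAt_regularSolutionDeriv_radial hε hr
  have hψd : ∀ r, 0 < r → HasDerivAt ψ (ψ₁ r) r := fun r hr =>
    hasDerivAt_sqrt_mul_comp_log hv hκ hr
  have hψ₁d : ∀ r, r₀ < r → HasDerivAt ψ₁ (p r * ψ r) r := fun r hr => by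
    rw [hp, radialCoeff_of_lt hε hβ hr (hr₀.trans hr)]
    exact hasDerivAt_div_sqrt_comp_log hv hw hκ (hr₀.trans hr)
  have hψ₁c : ContinuousAt ψ₁ r₀ := (hasDerivAt_div_sqrt_comp_log hv hw hκ hr₀).continuousAt
  have hφ₁c : ContinuousAt φ₁ r₀ :=
    (hasDerivAt_regularSolutionDeriv l (Λ / ε ^ 2 + κ ^ 2) hr₀.ne').continuousAt
  have huA : ContinuousAt u r₀ := huc.continuousAt (Ioi_mem_nhds hr₀)
  have hu₁A : ContinuousAt (deriv u) r₀ := hu₁c.continuousAt (Ioi_mem_nhds hr₀)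
  -- The equation is only known off `r₀`; continuity of `u` and `u'` carries the identity to `r₀`.
  have inner : u r₀ * φ₁ r₀ - deriv u r₀ * φ r₀ = 0 := by
    have hz : ∀ r ∈ Ioo 0 r₀, u r * φ₁ r - deriv u r * φ r = 0 := fun r hr =>
      wronskian_eq_zero_of_normalized hr₀ (fun r hr => hud r hr.1)
        (fun r hr => hu₁d r hr.1 hr.2.ne) (fun r _ => hφd r) hφ₁d hu.normalized
        (tendsto_regularSolution l _) hr
    have hc : ContinuousAt (fun r => u r * φ₁ r - deriv u r * φ r) r₀ :=
      (huA.mul (Complex.continuous_ofReal.continuousAt.comp hφ₁c)).sub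
        (hu₁A.mul (Complex.continuous_ofReal.continuousAt.comp (hφd r₀).continuousAt))
    refine tendsto_nhds_unique (hc.tendsto.mono_left nhdsWithin_le_nhds : Tendsto _ (𝓝[<] r₀) _)
      (tendsto_const_nhds.congr' ?_)
    filter_upwards [Ioo_mem_nhdsLT hr₀] with r hr using (hz r hr).symm
  have outer : u r₀ * ψ₁ r₀ - deriv u r₀ * ψ r₀ = 0 := by
    set b := efimovBeta ε l ^ 2 + 1 / 4 with hb
    set R := max (r₀ + 1) (b / κ ^ 2 + 1) with hR
    have hpR : ∀ r, R ≤ r → 0 ≤ p r := fun r hr => by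
      have h1 : r₀ + 1 ≤ r := (le_max_left _ _).trans hr
      have h2 : b / κ ^ 2 + 1 ≤ r := (le_max_right _ _).trans hr
      have hb0 : 0 ≤ b / κ ^ 2 := by positivity
      rw [hp, radialCoeff_of_lt hε hβ (by linarith) (by linarith), sub_nonneg,
        div_le_iff₀ (by nlinarith)]
      have h3 : b / κ ^ 2 ≤ r ^ 2 := by nlinarith
      rwa [div_le_iff₀' (by positivity)] at h3
    have huL : MemLp u 2 (volume.restrict (Ioi r₀)) :=
      hu.memLp.mono_measure (Measure.restrict_mono (Ioi_subset_Ioi hr₀.le) le_rfl)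
    have hψL : MemLp (fun r => (ψ r : ℂ)) 2 (volume.restrict (Ioi r₀)) :=
      (memLp_sqrt_mul_comp_log hv hw hvw hκ hr₀).ofReal
    have hz : ∀ r ∈ Ioi r₀, u r * ψ₁ r - deriv u r * ψ r = 0 := fun r hr =>
      wronskian_eq_zero_of_memLp (R := R)
        (lt_of_lt_of_le (by linarith : r₀ < r₀ + 1) (le_max_left _ _)) hpR
        (fun r hr => hud r (hr₀.trans hr)) (fun r hr => hu₁d r (hr₀.trans hr) (ne_of_gt hr))
        (y := fun r => (ψ r : ℂ)) (y₁ := fun r => (ψ₁ r : ℂ))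
        (fun r hr => (hψd r (hr₀.trans hr)).ofReal_comp)
        (fun r hr => ((hψ₁d r hr).ofReal_comp).congr_deriv (by push_cast; rfl)) huL hψL hr
    have hc : ContinuousAt (fun r => u r * ψ₁ r - deriv u r * ψ r) r₀ :=
      (huA.mul (Complex.continuous_ofReal.continuousAt.comp hψ₁c)).sub
        (hu₁A.mul (Complex.continuous_ofReal.continuousAt.comp (hψd r₀ hr₀).continuousAt))
    refine tendsto_nhds_unique (hc.tendsto.mono_left nhdsWithin_le_nhds : Tendsto _ (𝓝[>] r₀) _)
      (tendsto_const_nhds.congr' ?_)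
    filter_upwards [self_mem_nhdsWithin] with r hr using (hz r hr).symm
  -- Vanishing data would propagate inwards and contradict the normalisation at the origin.
  have hne : u r₀ ≠ 0 ∨ deriv u r₀ ≠ 0 := by
    by_contra! hzero
    have hz : ∀ δ ∈ Ioo 0 r₀, u δ = 0 := fun δ hδ => by
      have hsub : Icc δ r₀ ⊆ Ioi 0 := fun r hr => hδ.1.trans_le hr.1
      refine eq_zero_of_cauchy_data_eq_zero (p := p)
        (K := (l : ℝ) * (l + 1) / δ ^ 2 + |Λ / ε ^ 2 + κ ^ 2|) hδ.2
        (fun r hr => ?_) (huc.mono hsub) (hu₁c.mono hsub) (fun r hr => hud r (hδ.1.trans hr.1))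
        (fun r hr => hu₁d r (hδ.1.trans hr.1) hr.2.ne) hzero.1 hzero.2
      have hδ0 : 0 < δ := hδ.1
      have hr0 : 0 < r := hδ0.trans hr.1
      rw [hp, radialCoeff_of_le hε hr.2.le]
      refine (abs_add_le _ _).trans (add_le_add_left ?_ _)
      rw [abs_of_nonneg (by positivity)]
      have := hr.1.le
      gcongr
    have h1 : Tendsto (fun r : ℝ => (r ^ (l + 1))⁻¹ • u r) (𝓝[>] 0) (𝓝 0) := by
      refine tendsto_const_nhds.congr' ?_
      filter_upwards [Ioo_mem_nhdsGT hr₀] with r hr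
      rw [hz r hr, smul_zero]
    exact one_ne_zero (tendsto_nhds_unique hu.normalized h1)
  have key : (φ r₀ : ℂ) * ψ₁ r₀ - φ₁ r₀ * ψ r₀ = 0 := by
    rcases hne with h0 | h0
    · refine (mul_eq_zero.1 (?_ : u r₀ * _ = 0)).resolve_left h0
      linear_combination (φ r₀ : ℂ) * outer - (ψ r₀ : ℂ) * inner
    · refine (mul_eq_zero.1 (?_ : deriv u r₀ * _ = 0)).resolve_left h0
      linear_combination (φ₁ r₀ : ℂ) * outer - (ψ₁ r₀ : ℂ) * inner
  exact_mod_cast key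

theorem isAuxEigenvalue_of_wronskian_eq_zero (hε : 0 < ε) (hβ : 0 < efimovBetaSq ε l)
    (hr₀ : 0 < r₀) (hκ : 0 < κ) (hv : ∀ t, HasDerivAt v (w t) t)
    (hw : ∀ t, HasDerivAt w ((Real.exp (2 * t) - efimovBeta ε l ^ 2) * v t) t)
    (hvw : ∀ t, t₀ ≤ t → v t * w t ≤ 0) (hne : ∀ t, v t = 0 → w t ≠ 0)
    (h : regularSolution l (Λ / ε ^ 2 + κ ^ 2) r₀ *
        ((v (Real.log (κ * r₀)) / 2 + w (Real.log (κ * r₀))) / √r₀) -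
      regularSolutionDeriv l (Λ / ε ^ 2 + κ ^ 2) r₀ * (√r₀ * v (Real.log (κ * r₀))) = 0) :
    IsAuxEigenvalue ε l Λ r₀ (-(ε ^ 2 * κ ^ 2)) := by
  have hs := Real.sqrt_pos.2 hr₀
  have hψne : √r₀ * v (Real.log (κ * r₀)) = 0 →
      (v (Real.log (κ * r₀)) / 2 + w (Real.log (κ * r₀))) / √r₀ ≠ 0 := fun h0 => by
    have h1 : v (Real.log (κ * r₀)) = 0 := (mul_eq_zero.1 h0).resolve_left hs.ne'
    rw [h1, zero_div, zero_add]
    exact div_ne_zero (hne _ h1) hs.ne'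
  set φ := regularSolution l (Λ / ε ^ 2 + κ ^ 2) with hφ
  set φ₁ := regularSolutionDeriv l (Λ / ε ^ 2 + κ ^ 2) with hφ₁
  set ψ : ℝ → ℝ := fun r => √r * v (Real.log (κ * r)) with hψ
  set ψ₁ : ℝ → ℝ := fun r => (v (Real.log (κ * r)) / 2 + w (Real.log (κ * r))) / √r with hψ₁
  set p := radialCoeff ε l Λ r₀ κ with hp
  change φ r₀ * ψ₁ r₀ - φ₁ r₀ * ψ r₀ = 0 at h
  change ψ r₀ = 0 → ψ₁ r₀ ≠ 0 at hψne
  -- The recessive data form a nonzero vector, so a vanishing determinant makes the regular data a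
  -- multiple of it.
  obtain ⟨k, hk, hk₁⟩ : ∃ k, φ r₀ = k * ψ r₀ ∧ φ₁ r₀ = k * ψ₁ r₀ := by
    by_cases h0 : ψ r₀ = 0
    · have h1 := hψne h0
      refine ⟨φ₁ r₀ / ψ₁ r₀, ?_, by field_simp⟩
      rw [h0, mul_zero, sub_zero] at h
      rw [h0, mul_zero]
      exact (mul_eq_zero.1 h).resolve_right h1
    · refine ⟨φ r₀ / ψ r₀, by field_simp, ?_⟩
      field_simp
      linarith
  have hφd : ∀ r, HasDerivAt φ (φ₁ r) r := hasDerivAt_regularSolution l _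
  have hψd : ∀ r, 0 < r → HasDerivAt ψ (ψ₁ r) r := fun r hr =>
    hasDerivAt_sqrt_mul_comp_log hv hκ hr
  set U : ℝ → ℝ := fun r => if r ≤ r₀ then φ r else k * ψ r with hU
  set U₁ : ℝ → ℝ := fun r => if r ≤ r₀ then φ₁ r else k * ψ₁ r with hU₁
  have hUd : ∀ r, HasDerivAt U (U₁ r) r := fun r =>
    hasDerivAt_ite_le (f' := φ₁) (g' := fun r => k * ψ₁ r) (fun _ => hφd r)
      (fun hr => (hψd r (hr₀.trans_le hr)).const_mul k) hk hk₁
  have hU₁d : ∀ r, 0 < r → r ≠ r₀ → HasDerivAt U₁ (p r * U r) r := fun r hr hne => by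
    rcases lt_or_gt_of_ne hne with hlt | hgt
    · have h1 : U r = φ r := if_pos hlt.le
      rw [h1]
      refine (hasDerivAt_regularSolutionDeriv_radial hε ⟨hr, hlt⟩).congr_of_eventuallyEq ?_
      filter_upwards [Iio_mem_nhds hlt] with x hx using if_pos (le_of_lt hx)
    · have h1 : U r = k * ψ r := if_neg (not_le.2 hgt)
      have h2 := (hasDerivAt_div_sqrt_comp_log hv hw hκ hr).const_mul k
      rw [← radialCoeff_of_lt hε hβ hgt hr (Λ := Λ), mul_left_comm] at h2
      rw [h1]
      refine h2.congr_of_eventuallyEq ?_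
      filter_upwards [Ioi_mem_nhds hgt] with x hx using if_neg (not_le.2 hx)
  have hU₁c : ContinuousOn U₁ (Ioi 0) := by
    intro r hr
    by_cases hne' : r = r₀
    · subst hne'
      have c1 : ContinuousAt φ₁ r :=
        (hasDerivAt_regularSolutionDeriv l (Λ / ε ^ 2 + κ ^ 2) hr₀.ne').continuousAt
      have c2 : ContinuousAt (fun r => k * ψ₁ r) r :=
        ((hasDerivAt_div_sqrt_comp_log hv hw hκ hr₀).const_mul k).continuousAt
      refine ContinuousAt.continuousWithinAt ?_
      rw [continuousAt_iff_continuous_left_right]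
      constructor
      · exact c1.continuousWithinAt.congr (fun x hx => if_pos hx) (if_pos le_rfl)
      · refine c2.continuousWithinAt.congr (fun x hx => ?_) ((if_pos le_rfl).trans hk₁)
        rcases eq_or_lt_of_le (mem_Ici.1 hx) with rfl | hx
        · exact (if_pos le_rfl).trans hk₁
        · exact if_neg (not_le.2 hx)
    · exact (hU₁d r hr hne').continuousAt.continuousWithinAt
  set u : ℝ → ℂ := fun r => (U r : ℂ) with hu
  have hud : ∀ r, HasDerivAt u (U₁ r) r := fun r => (hUd r).ofReal_comp
  have hderiv : deriv u = fun r => (U₁ r : ℂ) := funext fun r => (hud r).deriv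
  have hu₁d : ∀ r, 0 < r → r ≠ r₀ → HasDerivAt (deriv u) (p r * u r) r := fun r hr hne => by
    rw [hderiv]
    exact ((hU₁d r hr hne).ofReal_comp).congr_deriv (by push_cast; rfl)
  have hnorm : Tendsto (fun r : ℝ => (r ^ (l + 1))⁻¹ • u r) (𝓝[>] 0) (𝓝 1) := by
    have h1 := (Complex.continuous_ofReal.tendsto 1).comp
      (tendsto_regularSolution l (Λ / ε ^ 2 + κ ^ 2))
    rw [Complex.ofReal_one] at h1
    refine h1.congr' ?_
    filter_upwards [Ioo_mem_nhdsGT hr₀] with r hr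
    have h2 : U r = φ r := if_pos hr.2.le
    simp only [Function.comp_apply, hu, h2, Complex.real_smul, Complex.ofReal_mul, hφ]
  refine ⟨u, ?_, fun r hr hne => (hu₁d r hr hne).differentiableAt, fun r hr hne => ?_, ?_, ?_,
    hnorm⟩
  · rw [show (1 : WithTop ℕ∞) = 0 + 1 by norm_num, contDiffOn_succ_iff_deriv_of_isOpen isOpen_Ioi]
    refine ⟨fun r _ => (hud r).differentiableAt.differentiableWithinAt, by simp, ?_⟩
    rw [contDiffOn_zero, hderiv]
    exact Complex.continuous_ofReal.comp_continuousOn hU₁c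
  · exact (radial_equation_iff hε r (u r) (deriv (deriv u) r)).2 (hu₁d r hr hne).deriv
  · have hUL : MemLp U 2 (volume.restrict (Ioi 0)) := by
      have hUc : Continuous U := continuous_iff_continuousAt.2 fun r => (hUd r).continuousAt
      rw [memLp_two_iff_integrable_sq hUc.aestronglyMeasurable]
      change IntegrableOn (fun r => U r ^ 2) (Ioi 0)
      rw [← Ioc_union_Ioi_eq_Ioi hr₀.le]
      refine IntegrableOn.union ?_ ?_
      · exact ((hUc.pow 2).continuousOn.integrableOn_Icc).mono_set Ioc_subset_Icc_self
      · have h1 := (memLp_sqrt_mul_comp_log hv hw hvw hκ hr₀).const_mul k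
        have h2 : IntegrableOn (fun r => (k * ψ r) ^ 2) (Ioi r₀) :=
          (memLp_two_iff_integrable_sq h1.1).1 h1
        refine h2.congr_fun (fun r hr => ?_) measurableSet_Ioi
        simp only [hU, if_neg (not_le.2 (mem_Ioi.1 hr))]
    exact hUL.ofReal
  · have h1 : Tendsto (fun r : ℝ => r ^ (l + 1)) (𝓝[>] 0) (𝓝 0) := by
      have := (continuous_pow (M := ℝ) (l + 1)).tendsto 0
      rw [zero_pow (Nat.succ_ne_zero l)] at this
      exact this.mono_left nhdsWithin_le_nhds
    have h2 := h1.smul hnorm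
    rw [zero_smul] at h2
    refine h2.congr' ?_
    filter_upwards [self_mem_nhdsWithin] with r hr
    have : r ≠ 0 := ne_of_gt hr
    rw [smul_smul, mul_inv_cancel₀ (pow_ne_zero _ this), one_smul]

end matching

/-! ### The phase of the matching condition. -/

/-- The Wronskian at `r₀` of the regular solution and the recessive solution, in terms of the data
at the logarithmic variable `τ`. -/
theorem wronskian_regular_recessive (l : ℕ) (q r₀ a b : ℝ) (hr₀ : 0 < r₀) :
    regularSolution l q r₀ * ((a / 2 + b) / √r₀) - regularSolutionDeriv l q r₀ * (√r₀ * a) =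
      r₀ ^ l * √r₀ * (hypLimit ((l : ℝ) + 3 / 2) (q * r₀ ^ 2 / 4) * b -
        (((l : ℝ) + 1 / 2) * hypLimit ((l : ℝ) + 3 / 2) (q * r₀ ^ 2 / 4) +
          2 * (q * r₀ ^ 2 / 4) * (hypLimit ((l : ℝ) + 3 / 2 + 1) (q * r₀ ^ 2 / 4) /
            ((l : ℝ) + 3 / 2))) * a) := by
  rw [regularSolution, regularSolutionDeriv]
  have hs := Real.sqrt_pos.2 hr₀
  have hss := Real.sq_sqrt hr₀.le
  have h1 : (a / 2 + b) / √r₀ = √r₀ * (a / 2 + b) / r₀ := by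
    rw [div_eq_div_iff hs.ne' hr₀.ne']
    linear_combination (-(a / 2 + b)) * hss
  rw [h1]
  have hc0 : (l : ℝ) + 3 / 2 ≠ 0 := by linarith [one_le_natCast_add l]
  generalize hypLimit ((l : ℝ) + 3 / 2 + 1) (q * r₀ ^ 2 / 4) / ((l : ℝ) + 3 / 2) = G
  generalize hypLimit ((l : ℝ) + 3 / 2) (q * r₀ ^ 2 / 4) = F
  rw [pow_succ]
  field_simp
  ring

/-- An increasing phase whose sine vanishes exactly where the regular solution with parameter
`m + e^{2τ}` matches the recessive solution. -/
theorem exists_matching_phase {β t₀ c m : ℝ} {v w : ℝ → ℝ} {C : ℂ} (hβ : 0 < β) (hc : 1 < c)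
    (hC : C ≠ 0) (hv : ∀ t, HasDerivAt v (w t) t)
    (hw : ∀ t, HasDerivAt w ((Real.exp (2 * t) - β ^ 2) * v t) t)
    (hvw : ∀ t, t₀ ≤ t → v t * w t ≤ 0) (hne : ∀ t, v t = 0 → w t ≠ 0)
    (hlim : Tendsto (fun t : ℝ => ((β : ℂ) * v t - Complex.I * w t) *
      Complex.exp (-(Complex.I * β * t))) atBot (𝓝 C)) :
    ∃ (θ : ℝ → ℝ) (d T : ℝ), StrictMono θ ∧ Continuous θ ∧
      Tendsto (fun t => θ t - β * t) atBot (𝓝 d) ∧ (∀ t, T ≤ t → Real.sin (θ t) ≠ 0) ∧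
      ∀ t, Real.sin (θ t) = 0 ↔
        hypLimit c ((m + Real.exp (2 * t)) / 4) * w t -
          ((c - 1) * hypLimit c ((m + Real.exp (2 * t)) / 4) +
            2 * ((m + Real.exp (2 * t)) / 4) * (hypLimit (c + 1) ((m + Real.exp (2 * t)) / 4) / c)) *
              v t = 0 := by
  have hc1 : 1 ≤ c + 1 := by linarith
  set z : ℝ → ℝ := fun t => (m + Real.exp (2 * t)) / 4 with hz
  have hzd : ∀ t, HasDerivAt z (Real.exp (2 * t) / 2) t := fun t => by
    have h1 : HasDerivAt (fun t : ℝ => 2 * t) 2 t := by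
      simpa using (hasDerivAt_id t).const_mul (2 : ℝ)
    refine HasDerivAt.congr_deriv ((h1.exp.const_add m).div_const 4) ?_
    ring
  set f : ℝ → ℝ := fun x => hypLimit c x with hf
  set g : ℝ → ℝ := fun x => hypLimit (c + 1) x / c with hg
  set k : ℝ → ℝ := fun x => hypLimit (c + 1 + 1) x / (c + 1) / c with hk
  have hfd : ∀ x, HasDerivAt f (g x) x := hasDerivAt_hypLimit_real hc.le
  have hgd : ∀ x, HasDerivAt g (k x) x := fun x => (hasDerivAt_hypLimit_real hc1 x).div_const c
  have hode : ∀ x, x * k x + c * g x = f x := hypLimit_contiguous (one_le_norm_add_natCast hc.le)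
  have hH : ∀ x, 0 < f x ^ 2 - (c - 1) * f x * g x - x * g x ^ 2 := hypLimit_form_pos hc.le
  have hfc : Continuous f := continuous_iff_continuousAt.2 fun x => (hfd x).continuousAt
  have hgc : Continuous g := continuous_iff_continuousAt.2 fun x => (hgd x).continuousAt
  have hzc : Continuous z := continuous_iff_continuousAt.2 fun x => (hzd x).continuousAt
  have hvc : Continuous v := continuous_iff_continuousAt.2 fun x => (hv x).continuousAt
  have hwc : Continuous w := continuous_iff_continuousAt.2 fun x => (hw x).continuousAt
  set P : ℝ → ℝ := fun t => f (z t) with hP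
  set Q : ℝ → ℝ := fun t => (c - 1) * f (z t) + 2 * z t * g (z t) with hQ
  set P' : ℝ → ℝ := fun t => g (z t) * (Real.exp (2 * t) / 2) with hP'
  set Q' : ℝ → ℝ := fun t => (2 * f (z t) - (c - 1) * g (z t)) * (Real.exp (2 * t) / 2) with hQ'
  have hPd : ∀ t, HasDerivAt P (P' t) t := fun t => HasDerivAt.comp (h₂ := f) t (hfd _) (hzd t)
  have hQd : ∀ t, HasDerivAt Q (Q' t) t := fun t => by
    refine HasDerivAt.congr_deriv (((hPd t).const_mul (c - 1)).add (((hzd t).const_mul 2).mul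
      (HasDerivAt.comp (h₂ := g) t (hgd _) (hzd t)))) ?_
    simp only [hP', hQ', ← hode]
    ring
  -- The expression equals `e^{2t}` times the form of `hypLimit_form_pos`.
  have hform : ∀ t, 0 < P t * Q' t - Q t * P' t := fun t => by
    have := mul_pos (Real.exp_pos (2 * t)) (hH (z t))
    simp only [hP, hQ, hP', hQ']
    linarith
  -- Chosen so that `Im (Z Y) = -β (P w - Q v)`: the phase of `Z Y` is a multiple of `π` exactly at
  -- a match.
  set Z : ℝ → ℂ := fun t => (β : ℂ) * v t - Complex.I * w t with hZ
  set Z' : ℝ → ℂ := fun t => (β : ℂ) * w t -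
    Complex.I * ((Real.exp (2 * t) - β ^ 2) * v t : ℝ) with hZ'
  set Y : ℝ → ℂ := fun t => (β : ℂ) * P t + Complex.I * Q t with hY
  set Y' : ℝ → ℂ := fun t => (β : ℂ) * P' t + Complex.I * Q' t with hY'
  have hZd : ∀ t, HasDerivAt Z (Z' t) t := fun t =>
    ((hv t).ofReal_comp.const_mul _).sub ((hw t).ofReal_comp.const_mul _)
  have hYd : ∀ t, HasDerivAt Y (Y' t) t := fun t =>
    ((hPd t).ofReal_comp.const_mul _).add ((hQd t).ofReal_comp.const_mul _)
  have hZre : ∀ t, (Z t).re = β * v t := fun t => by simp [hZ]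
  have hZim : ∀ t, (Z t).im = -w t := fun t => by simp [hZ]
  have hYre : ∀ t, (Y t).re = β * P t := fun t => by simp [hY]
  have hYim : ∀ t, (Y t).im = Q t := fun t => by simp [hY]
  have hY're : ∀ t, (Y' t).re = β * P' t := fun t => by simp [hY']
  have hY'im : ∀ t, (Y' t).im = Q' t := fun t => by simp [hY']
  have hZ're : ∀ t, (Z' t).re = β * w t := fun t => by
    simp only [hZ', Complex.sub_re, Complex.re_ofReal_mul, Complex.ofReal_re, Complex.I_mul_re,
      Complex.ofReal_im]
    ring
  have hZ'im : ∀ t, (Z' t).im = -((Real.exp (2 * t) - β ^ 2) * v t) := fun t => by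
    simp only [hZ', Complex.sub_im, Complex.im_ofReal_mul, Complex.ofReal_re, Complex.I_mul_im,
      Complex.ofReal_im]
    ring
  have hZ0 : ∀ t, Z t ≠ 0 := fun t h0 => by
    have h1 := hZre t
    have h2 := hZim t
    rw [h0, Complex.zero_re] at h1
    rw [h0, Complex.zero_im] at h2
    exact hne t ((mul_eq_zero.1 h1.symm).resolve_left hβ.ne') (by linarith)
  have hfQ : ∀ x, f x = 0 → (c - 1) * f x + 2 * x * g x ≠ 0 := fun x h1 h2 => by
    have h3 := hH x
    rw [h1] at h2 h3
    have h4 : x * g x = 0 := by linarith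
    have h5 : x * g x ^ 2 = 0 := by rw [pow_two, ← mul_assoc, h4, zero_mul]
    rw [h5] at h3
    norm_num at h3
  have hYne : ∀ x, (β : ℂ) * f x + Complex.I * ((c - 1) * f x + 2 * x * g x : ℝ) ≠ 0 :=
    fun x h0 => by
    have h1 := congrArg Complex.re h0
    have h2 := congrArg Complex.im h0
    simp only [Complex.add_re, Complex.add_im, Complex.re_ofReal_mul, Complex.im_ofReal_mul,
      Complex.I_mul_re, Complex.I_mul_im, Complex.ofReal_re, Complex.ofReal_im, Complex.zero_re,
      Complex.zero_im, mul_zero, neg_zero, add_zero, zero_add] at h1 h2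
    exact hfQ x ((mul_eq_zero.1 h1).resolve_left hβ.ne') h2
  have hY0 : ∀ t, Y t ≠ 0 := fun t => hYne (z t)
  have hMd : ∀ t, HasDerivAt (fun t => Z t * Y t) (Z' t * Y t + Z t * Y' t) t := fun t =>
    (hZd t).mul (hYd t)
  have hMc : Continuous fun t => Z' t * Y t + Z t * Y' t := by
    simp only [hZ, hZ', hY, hY', hP, hP', hQ, hQ']
    fun_prop
  obtain ⟨L, hLd, hLexp⟩ := exists_complex_log_lift hMd hMc fun t => mul_ne_zero (hZ0 t) (hY0 t)
  have hθd : ∀ t, HasDerivAt (fun t => (L t).im) ((Z' t / Z t).im + (Y' t / Y t).im) t :=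
    fun t => by
    refine HasDerivAt.congr_deriv (Complex.imCLM.hasFDerivAt.comp_hasDerivAt t (hLd t)) ?_
    rw [Complex.imCLM_apply, ← Complex.add_im]
    congr 1
    have := hZ0 t
    have := hY0 t
    field_simp
  -- The two angular speeds are `β` times the recessive form over `|Z|²` and `β` times the regular
  -- form over `|Y|²`.
  have hpos : ∀ t, 0 < (Z' t / Z t).im + (Y' t / Y t).im := fun t => by
    have h1 := recessive_form_pos hv hw hvw hne t
    have h2 := hform t
    have n1 := Complex.normSq_pos.2 (hZ0 t)
    have n2 := Complex.normSq_pos.2 (hY0 t)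
    rw [Complex.div_im, Complex.div_im, ← sub_div, ← sub_div, hZre, hZim, hZ're, hZ'im, hYre, hYim,
      hY're, hY'im]
    refine add_pos (div_pos ?_ n1) (div_pos ?_ n2)
    · have := mul_pos hβ h1
      linarith
    · have := mul_pos hβ h2
      linarith
  have hM_im : ∀ t, (Z t * Y t).im = -β * (P t * w t - Q t * v t) := fun t => by
    rw [Complex.mul_im, hZre, hZim, hYre, hYim]
    ring
  have hsin : ∀ t, Real.sin (L t).im = 0 ↔ P t * w t - Q t * v t = 0 := fun t => by
    have h1 := hM_im t
    rw [← hLexp, Complex.exp_im] at h1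
    have h2 := (Real.exp_pos (L t).re).ne'
    constructor
    · intro h
      rw [h, mul_zero] at h1
      exact (mul_eq_zero.1 h1.symm).resolve_left (neg_ne_zero.2 hβ.ne')
    · intro h
      rw [h, mul_zero] at h1
      exact (mul_eq_zero.1 h1).resolve_left h2
  obtain ⟨d, hd⟩ : ∃ d, Tendsto (fun t : ℝ => L t - Complex.I * β * t) atBot (𝓝 d) := by
    have hz0 : Tendsto z atBot (𝓝 (m / 4)) := by
      have h1 : Tendsto (fun t : ℝ => 2 * t) atBot atBot := tendsto_id.const_mul_atBot two_pos
      have h2 := ((Real.tendsto_exp_atBot.comp h1).const_add m).div_const 4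
      rw [add_zero] at h2
      exact h2
    have hYlim : Tendsto Y atBot (𝓝 ((β : ℂ) * f (m / 4) +
        Complex.I * ((c - 1) * f (m / 4) + 2 * (m / 4) * g (m / 4) : ℝ))) := by
      have h1 : Continuous fun x : ℝ => (β : ℂ) * f x +
          Complex.I * ((c - 1) * f x + 2 * x * g x : ℝ) := by fun_prop
      exact (h1.tendsto (m / 4)).comp hz0
    refine exists_tendsto_of_tendsto_exp (g' := fun t => (Z' t * Y t + Z t * Y' t) / (Z t * Y t) -
      Complex.I * β) (fun t => ?_) (mul_ne_zero hC (hYne (m / 4))) ?_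
    · have h1 : HasDerivAt (fun t : ℝ => Complex.I * β * (t : ℂ)) (Complex.I * β) t := by
        simpa using (hasDerivAt_id t).ofReal_comp.const_mul (Complex.I * (β : ℂ))
      exact (hLd t).sub h1
    · refine (hlim.mul hYlim).congr fun t => ?_
      rw [sub_eq_add_neg (L t), Complex.exp_add, hLexp]
      ring
  refine ⟨fun t => (L t).im, d.im, max t₀ |m|, strictMono_of_deriv_pos fun t => ?_,
    continuous_iff_continuousAt.2 fun t => (hθd t).continuousAt, ?_, fun t ht h0 => ?_, hsin⟩
  · rw [(hθd t).deriv]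
    exact hpos t
  · refine ((Complex.continuous_im.tendsto d).comp hd).congr fun t => ?_
    simp
  -- For `t ≥ |m|`, `e^{2t} ≥ 1 + 2t` gives `z t ≥ 0`, so `P ≥ 1` and, as `c > 1`, `Q > 0`. A match
  -- would require `P v w = Q v² > 0`, against `v w ≤ 0`.
  · have ht0 : t₀ ≤ t := (le_max_left _ _).trans ht
    have htm : |m| ≤ t := (le_max_right _ _).trans ht
    have hz0 : 0 ≤ z t := by
      have h1 := Real.add_one_le_exp (2 * t)
      have h2 := neg_abs_le m
      have h3 := abs_nonneg m
      simp only [hz]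
      linarith
    have hf1 : 1 ≤ P t := one_le_hypLimit hc.le hz0
    have hg1 : 0 ≤ g (z t) := div_nonneg (zero_le_one.trans (one_le_hypLimit hc1 hz0)) (by linarith)
    have hQ0 : 0 < Q t := by
      have h1 : 0 < (c - 1) * f (z t) := mul_pos (by linarith) (zero_lt_one.trans_le hf1)
      have h2 : 0 ≤ 2 * z t * g (z t) := by positivity
      exact add_pos_of_pos_of_nonneg h1 h2
    have hv0 := recessive_ne_zero hv hvw hne ht0
    have h1 := (hsin t).1 h0
    have h2 : 0 < v t ^ 2 * Q t := by positivity
    have h3 : P t * (v t * w t) ≤ 0 :=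
      mul_nonpos_of_nonneg_of_nonpos (by linarith) (hvw t ht0)
    have h4 : v t * (P t * w t - Q t * v t) = 0 := by rw [h1, mul_zero]
    linarith

end

/-! ### The spectrum and the geometric law. -/

/-- The negative eigenvalues, listed in increasing order, form an infinite sequence `E 0 < E 1 < …`
that tends to `0` and obeys the geometric law. -/
theorem mainTheorem4 (ε : ℝ) (hε : 0 < ε) (l : ℕ) (hβ : 0 < efimovBetaSq ε l)
    (Λ : ℝ) (hΛ : Λ ≤ 0) (r₀ : ℝ) (hr₀ : 0 < r₀) :
    ∃ E : ℕ → ℝ, StrictMono E ∧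
      Set.range E = {e : ℝ | e < 0 ∧ IsAuxEigenvalue ε l Λ r₀ e} ∧
      Tendsto E atTop (𝓝 0) ∧
      Tendsto (fun n : ℕ => E n / E (n + 1)) atTop
        (𝓝 (Real.exp (2 * Real.pi / efimovBeta ε l))) := by
  have hβ' : 0 < efimovBeta ε l := Real.sqrt_pos.2 hβ
  obtain ⟨v, w, t₀, C, hC, hv, hw, hvw, hne, hlim⟩ := exists_recessive_solution hβ'
  have hl : (1 : ℝ) < (l : ℝ) + 3 / 2 := by
    have : (0 : ℝ) ≤ l := l.cast_nonneg
    linarith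
  obtain ⟨θ, d, T, hmono, hcont, hθ, hT, hsin⟩ :=
    exists_matching_phase (m := Λ / ε ^ 2 * r₀ ^ 2) hβ' hl hC hv hw hvw hne hlim
  obtain ⟨τ, hanti, hrange, hbot, hgap⟩ := exists_phase_sequence hβ' hmono hcont hθ hT
  -- The momentum for which `log(κr₀) = t`.
  set κ : ℝ → ℝ := fun t => Real.exp t / r₀ with hκ
  have hκ0 : ∀ t, 0 < κ t := fun t => by positivity
  have heig : ∀ t, IsAuxEigenvalue ε l Λ r₀ (-(ε ^ 2 * κ t ^ 2)) ↔ Real.sin (θ t) = 0 := by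
    intro t
    have hlog : Real.log (κ t * r₀) = t := by
      simp only [hκ]
      rw [div_mul_cancel₀ _ hr₀.ne', Real.log_exp]
    have harg : (Λ / ε ^ 2 + κ t ^ 2) * r₀ ^ 2 / 4 =
        (Λ / ε ^ 2 * r₀ ^ 2 + Real.exp (2 * t)) / 4 := by
      have : Real.exp (2 * t) = Real.exp t ^ 2 := by rw [← Real.exp_nat_mul]; norm_num
      simp only [hκ]
      rw [this]
      field_simp
    have hwr := wronskian_regular_recessive l (Λ / ε ^ 2 + κ t ^ 2) r₀ (v t) (w t) hr₀
    -- With `c = l + 3/2` the coefficient `l + 1/2` is the `c - 1` of the matching phase.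
    rw [harg, show (l : ℝ) + 1 / 2 = (l : ℝ) + 3 / 2 - 1 by ring] at hwr
    have hscale : r₀ ^ l * √r₀ ≠ 0 := by positivity
    rw [hsin]
    constructor
    · intro h
      have h1 := wronskian_eq_zero_of_isAuxEigenvalue hε hβ hr₀ (hκ0 t) hv hw hvw h
      rw [hlog, hwr] at h1
      exact (mul_eq_zero.1 h1).resolve_left hscale
    · intro h
      refine isAuxEigenvalue_of_wronskian_eq_zero hε hβ hr₀ (hκ0 t) hv hw hvw hne ?_
      rw [hlog, hwr, h, mul_zero]
  refine ⟨fun n => -(ε ^ 2 * κ (τ n) ^ 2), fun a b hab => ?_, ?_, ?_, ?_⟩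
  · have h1 : κ (τ b) < κ (τ a) :=
      div_lt_div_of_pos_right (Real.exp_lt_exp.2 (hanti hab)) hr₀
    have h2 : κ (τ b) ^ 2 < κ (τ a) ^ 2 := pow_lt_pow_left₀ h1 (hκ0 _).le two_ne_zero
    have h3 : 0 < ε ^ 2 := by positivity
    simp only
    nlinarith
  · ext e
    constructor
    · rintro ⟨n, rfl⟩
      have h1 : 0 < ε ^ 2 * κ (τ n) ^ 2 := by have := hκ0 (τ n); positivity
      exact ⟨by simpa using h1, (heig _).2 (hrange.subset (mem_range_self n))⟩
    · rintro ⟨he, hE⟩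
      have hs : 0 < √(-e) := Real.sqrt_pos.2 (by linarith)
      -- Every negative `e` is reached: solve `e = -ε² e^{2t} / r₀²` for `t`.
      have he' : e = -(ε ^ 2 * κ (Real.log (r₀ * √(-e) / ε)) ^ 2) := by
        simp only [hκ]
        rw [Real.exp_log (by positivity)]
        have := Real.sq_sqrt (neg_pos.2 he).le
        field_simp
        linarith
      rw [he'] at hE
      have h1 : Real.log (r₀ * √(-e) / ε) ∈ range τ := hrange.symm.subset ((heig _).1 hE)
      obtain ⟨n, hn⟩ := h1
      exact ⟨n, by simp only [hn]; exact he'.symm⟩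
  · have h1 : Tendsto (fun n => κ (τ n)) atTop (𝓝 (0 / r₀)) :=
      (Real.tendsto_exp_atBot.comp hbot).div_const r₀
    have h2 := ((h1.pow 2).const_mul (ε ^ 2)).neg
    simpa using h2
  · have h1 : Tendsto (fun n => Real.exp (2 * (τ n - τ (n + 1)))) atTop
        (𝓝 (Real.exp (2 * (π / efimovBeta ε l)))) :=
      (Real.continuous_exp.tendsto _).comp (hgap.const_mul 2)
    rw [← mul_div_assoc] at h1
    refine h1.congr fun n => ?_
    simp only [hκ]
    rw [mul_sub, Real.exp_sub, mul_comm 2, mul_comm 2, Real.exp_mul, Real.exp_mul]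
    have := Real.exp_pos (τ (n + 1))
    norm_num
    field_simp
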